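/- Consider a sequence of stochastic block models with loops. The model with $N$ vertices has $M=M(N)\ge 1$ disjoint blocks of equal size $N/M\in\mathbb N$, where $N\to\infty$ and $M=o(N)$ (for example, $M$ constant). For every unordered pair $\{v,w\}$ of vertices, $v=w$ included, the edge $\{v,w\}$ is present independently of all others, with probability $p_m=p_m(N)\in[0,1]$ if $v$ and $w$ both lie in block $m$, and with probability $q=q(N)\in[0,1]$ if they lie in different blocks. Put $$\gamma_m=\frac NM p_m+(M-1)\frac NM q\quad(1\le m\le M),\qquad \gamma_{\min}=\min_m\gamma_m,\quad \gamma_{\max}=\max_m\gamma_m,\quad p_{\min}=\min_m p_m,\quad p_{\max}=\max_m p_m,$$ and suppose that $\gamma_{\min}>0$ for all large $N$. Assume the connectivity condition $$\frac{M\log^4 N}{Np_m+N(M-1)q}\cdot\frac{\gamma_{\max}^2}{\gamma_{\min}^2}\longrightarrow 0\qquad(N\to\infty)\quad\text{for all } m$$ (for every choice of a block $m=m(N)$), and the lower bound on $q$ $$\Big(\frac{M\log N}{N}\Big)^{1/4}p_{\min}^{5/4}\,p_{\max}^{1/2}=o\big(((M-1)q)^2\big).$$ For a realization of the graph let $d_v$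 be the degree of $v$ (a loop counts once), let $\pi_v=d_v/\sum_{u}d_u$, and let $H_{vw}$ be the expected number of steps that the simple random walk started in $v$ needs to reach $w$ (so $H_{vv}=0$; the walk moves in each step to a uniformly chosen neighbour). Let $H^v=\sum_w\pi_wH_{vw}$ be the hitting time from $v$ averaged over the target vertex. Then asymptotically almost surely the graph is connected and $H^v=N(1+o(1))$ for all vertices $v$; that is, for every $\delta>0$, $$\mathbb P\Big(\text{the graph is connected and } (1-\delta)N\le H^v\le(1+\delta)N\text{ for all }v\Big)\longrightarrow 1 .$$ -/

import Mathlib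

open MeasureTheory ProbabilityTheory Filter Topology Asymptotics
open scoped ENNReal

namespace SBM

noncomputable section

/-- Vertices of the stochastic block model with `M` blocks of `n` vertices each (so `N = M * n`
vertices in total): the vertex `v = (m, i)` is the `i`-th vertex of the block `m`. -/
abbrev Vertex (M n : ℕ) : Type := Fin M × Fin n

/-- Probability that the unordered pair `{v, w}` is an edge: `p m` if both ends are in block `m`
(in particular for a loop `{v, v}`), and `q` if the ends lie in different blocks. -/
def edgeProb {M n : ℕ} (p : Fin M → unitInterval) (q : unitInterval) :
    Sym2 (Vertex M n) → unitInterval :=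
  Sym2.lift ⟨fun v w => if v.1 = w.1 then p v.1 else q, by
    intro v w
    by_cases h : v.1 = w.1
    · simp [h]
    · simp [h, Ne.symm h]⟩

/-- Law of the stochastic block model on the set of graphs with loops on `Vertex M n`. A graph is
given by its edge indicators `ε : Sym2 (Vertex M n) → Bool`; these are independent, and
`ε e = true` has probability `edgeProb p q e`. -/
def law {M : ℕ} (n : ℕ) (p : Fin M → unitInterval) (q : unitInterval) :
    Measure (Sym2 (Vertex M n) → Bool) :=
  Measure.pi fun e => bernoulliMeasure true false (edgeProb p q e)

section Walk

variable {V : Type*} [Fintype V]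

/-- The neighbours of `v` in the graph with edge indicators `ε` (`v` itself is one of them if there
is a loop at `v`). -/
def neighbors (ε : Sym2 V → Bool) (v : V) : Finset V :=
  Finset.univ.filter fun w => ε s(v, w) = true

/-- The degree of `v`; a loop contributes one. -/
def degree (ε : Sym2 V → Bool) (v : V) : ℕ := (neighbors ε v).card

/-- The graph with edge indicators `ε` is connected. (Loops are irrelevant for this.) -/
def IsConnected (ε : Sym2 V → Bool) : Prop :=
  (SimpleGraph.fromEdgeSet {e | ε e = true}).Connected

/-- The invariant distribution `π v = d v / ∑ w, d w` of the simple random walk. -/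
def stationary (ε : Sym2 V → Bool) (v : V) : ℝ≥0∞ :=
  (degree ε v : ℝ≥0∞) / ∑ w, (degree ε w : ℝ≥0∞)

open Classical in
/-- One step of the simple random walk from `v`: a uniformly chosen neighbour. (By convention the
walk stays put at a vertex that has no neighbour.) -/
def step (ε : Sym2 V → Bool) (v : V) : PMF V :=
  if h : (neighbors ε v).Nonempty then PMF.uniformOfFinset (neighbors ε v) h else PMF.pure v

variable [MeasurableSpace V] [MeasurableSingletonClass V]

/-- The transition kernel of the simple random walk. -/
def stepKernel (ε : Sym2 V → Bool) : Kernel V V :=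
  Kernel.ofFunOfCountable fun v => (step ε v).toMeasure

instance (ε : Sym2 V → Bool) : IsMarkovKernel (stepKernel ε) :=
  ⟨fun v => inferInstanceAs (IsProbabilityMeasure (step ε v).toMeasure)⟩

/-- The conditional law of the position at time `t + 1` given the trajectory up to time `t`: it is
the step distribution from the position at time `t`. -/
def historyKernel (ε : Sym2 V → Bool) (t : ℕ) : Kernel ((i : Finset.Iic t) → V) V :=
  (stepKernel ε).comap (fun x => x ⟨t, Finset.mem_Iic.2 le_rfl⟩) (measurable_pi_apply _)

instance (ε : Sym2 V → Bool) (t : ℕ) : IsMarkovKernel (historyKernel ε t) := by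
  unfold historyKernel
  infer_instance

/-- The law, on the space `ℕ → V` of trajectories, of the simple random walk `X₀, X₁, …` started in
`X₀ = v`. -/
def walkLaw (ε : Sym2 V → Bool) (v : V) : Measure (ℕ → V) :=
  Kernel.trajMeasure (X := fun _ => V) (Measure.dirac v) (historyKernel ε)

/-- The first time `t ≥ 0` at which the trajectory `x` is in `w`, and `∞` if there is none. -/
def firstHit (w : V) (x : ℕ → V) : ℝ≥0∞ := ⨅ (t : ℕ) (_ : x t = w), (t : ℝ≥0∞)

/-- `H_{vw}`: the expected time that the walk started in `v` needs to reach `w`. -/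
def hittingTime (ε : Sym2 V → Bool) (v w : V) : ℝ≥0∞ := ∫⁻ x, firstHit w x ∂walkLaw ε v

/-- `H^v = ∑ w, π w * H_{vw}`: the hitting time from `v`, averaged over the target vertex. -/
def avgHittingTime (ε : Sym2 V → Bool) (v : V) : ℝ≥0∞ :=
  ∑ w, stationary ε w * hittingTime ε v w

end Walk

/-- The expected degree `γ_m = (N / M) p_m + (M - 1) (N / M) q` of a vertex in block `m`, where
`N / M = n`. -/
def expDegree {M : ℕ} (n : ℕ) (p : Fin M → unitInterval) (q : unitInterval) (m : Fin M) : ℝ :=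
  n * (p m : ℝ) + ((M : ℝ) - 1) * n * (q : ℝ)

end

end SBM

/-! Let `P` be the transition matrix. On a connected graph the averaged hitting time is Kemeny's
constant: with `Z` the inverse of `I - P + 1πᵀ`, one has `H v w = (Z w w - Z v w) / π w`, and since
the rows of `Z` sum to 1, `H^v = tr Z - 1` for every start `v`. Uniformity in `v` therefore costs
nothing, and only a trace has to be estimated.

Put `C = P - 1πᵀ`. Then `Z = 1 + C + C Z C`. In the inner product weighted by degrees, `Z` is
positive and at most `1 / g`, where `g` is a spectral gap, so `0 ≤ tr (C Z C) ≤ tr (C²) / g`. For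
minimal degree at least `h`, both `tr P` and `tr (C²)` are at most `N / h`, whence `N - 2 ≤ H^v ≤ N
(1 + 1/h + 1/(h g))`. A crude gap is enough: Cheeger's inequality gives `g = h² / (2 D²)` for edge
expansion `h` and maximal degree `D` (`IsExpanding.avgHittingTime_bounds`).

In the random graph only edges between blocks are used for expansion. With `c = (M - 1) n q`,
Chernoff bounds and a union over all vertex sets give `h = c / 4`; degrees are at most `3 γ_max`
(`measureReal_not_expanding_le`). It remains that `c³` exceeds any constant multiple of `γ_max² log
N`, which follows from the two asymptotic assumptions (`cut_dominates`). This also makes `c` large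
compared with `log N`, as the union bound requires. -/

namespace SBM

/-! ### Edge expansion and Cheeger's inequality -/

section WeightedGraph

variable {V : Type*} [Fintype V] [DecidableEq V]

/-- The Dirichlet form of the weighted graph with weight matrix `A`. -/
noncomputable def dirichletForm (A : Matrix V V ℝ) (f : V → ℝ) : ℝ :=
  (∑ v, ∑ w, A v w * (f v - f w) ^ 2) / 2

/-- Every vertex set `S` with at most half of the vertices has a boundary of weight at least
`h * |S|`. -/
def IsExpanding (A : Matrix V V ℝ) (h : ℝ) : Prop :=
  ∀ S : Finset V, S.Nonempty → 2 * S.card ≤ Fintype.card V →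
    h * S.card ≤ ∑ v ∈ S, ∑ w ∈ Sᶜ, A v w

variable {A : Matrix V V ℝ} {h : ℝ}

lemma sum_abs_indicator_sub_eq_cut (hA : A.IsSymm) (S : Finset V) :
    ∑ v, ∑ w, A v w * |(if v ∈ S then (1 : ℝ) else 0) - if w ∈ S then 1 else 0|
      = 2 * ∑ v ∈ S, ∑ w ∈ Sᶜ, A v w := by
  have h1 : ∑ v ∈ S, ∑ w, A v w * |(if v ∈ S then (1 : ℝ) else 0) - if w ∈ S then 1 else 0|
      = ∑ v ∈ S, ∑ w ∈ Sᶜ, A v w := by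
    refine Finset.sum_congr rfl fun v hv => ?_
    rw [← Finset.sum_add_sum_compl S, Finset.sum_eq_zero, zero_add]
    · refine Finset.sum_congr rfl fun w hw => ?_
      simp [hv, Finset.mem_compl.1 hw]
    · intro w hw
      simp [hv, hw]
  have h2 : ∑ v ∈ Sᶜ, ∑ w, A v w * |(if v ∈ S then (1 : ℝ) else 0) - if w ∈ S then 1 else 0|
      = ∑ v ∈ Sᶜ, ∑ w ∈ S, A v w := by
    refine Finset.sum_congr rfl fun v hv => ?_
    rw [← Finset.sum_add_sum_compl S, add_comm, Finset.sum_eq_zero, zero_add]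
    · refine Finset.sum_congr rfl fun w hw => ?_
      simp [hw, Finset.mem_compl.1 hv]
    · intro w hw
      simp [Finset.mem_compl.1 hv, Finset.mem_compl.1 hw]
  have h3 : ∑ v ∈ Sᶜ, ∑ w ∈ S, A v w = ∑ v ∈ S, ∑ w ∈ Sᶜ, A v w :=
    Finset.sum_comm.trans
      (Finset.sum_congr rfl fun v _ => Finset.sum_congr rfl fun w _ => hA.apply _ _)
  rw [← Finset.sum_add_sum_compl S, h1, h2, h3, two_mul]

/-- A discrete coarea argument: every positive superlevel set of `u` has at most half of the
vertices, so expansion applies to it. The induction peels off the lowest positive level `t` on the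
support `S`; the mass and the total variation both split additively, and the support shrinks. -/
lemma IsExpanding.mul_sum_le (hexp : IsExpanding A h) (hA : A.IsSymm) (u : V → ℝ)
    (hu : ∀ v, 0 ≤ u v)
    (hsupp : 2 * (Finset.univ.filter fun v => 0 < u v).card ≤ Fintype.card V) :
    h * ∑ v, u v ≤ (∑ v, ∑ w, A v w * |u v - u w|) / 2 := by
  induction hk : (Finset.univ.filter fun v => 0 < u v).card using Nat.strong_induction_on
    generalizing u with
  | _ k ih =>
    set S := Finset.univ.filter fun v => 0 < u v with hS
    rcases S.eq_empty_or_nonempty with hemp | hne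
    · have hz : ∀ v, u v = 0 := fun v => by
        have : v ∉ S := by simp [hemp]
        exact le_antisymm (by simpa [hS] using this) (hu v)
      simp [hz]
    · obtain ⟨v₀, hv₀, hmin⟩ := S.exists_min_image u hne
      have ht : 0 < u v₀ := by simpa [hS] using hv₀
      set t := u v₀
      set u' : V → ℝ := fun v => if v ∈ S then u v - t else 0 with hu'
      have hu'0 : ∀ v, 0 ≤ u' v := fun v => by
        by_cases hv : v ∈ S
        · simpa [hu', hv] using hmin v hv
        · simp [hu', hv]
      have hsub : (Finset.univ.filter fun v => 0 < u' v) ⊂ S := by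
        refine Finset.ssubset_iff_of_subset (fun v hv => ?_) |>.2 ⟨v₀, hv₀, ?_⟩
        · by_contra hvS
          simp [hu', hvS] at hv
        · simp [hu', t]
      have hcard := Finset.card_lt_card hsub
      have hrec := ih _ (hk ▸ hcard) u' hu'0 (by lia) rfl
      have hcut := hexp S hne hsupp
      have hdecomp : ∀ v, u v = t * (if v ∈ S then 1 else 0) + u' v := fun v => by
        by_cases hv : v ∈ S
        · simp [hu', hv]
        · have : u v = 0 := le_antisymm (by simpa [hS] using hv) (hu v)
          simp [hu', hv, this]
      have habs : ∀ v w, |u v - u w| = t * |(if v ∈ S then (1 : ℝ) else 0) - if w ∈ S then 1 else 0|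
          + |u' v - u' w| := fun v w => by
        have h1 := hu'0 v
        have h2 := hu'0 w
        by_cases hv : v ∈ S <;> by_cases hw : w ∈ S
        · rw [hdecomp v, hdecomp w]; simp [hv, hw]
        · have hw' : u' w = 0 := by simp [hu', hw]
          rw [hdecomp v, hdecomp w, hw']
          simp only [hv, hw, if_true, if_false]
          rw [abs_of_nonneg (by linarith), abs_of_nonneg (a := u' v - 0) (by linarith)]
          norm_num
        · have hv' : u' v = 0 := by simp [hu', hv]
          rw [hdecomp v, hdecomp w, hv']
          simp only [hv, hw, if_true, if_false]
          rw [abs_of_nonpos (by linarith), abs_of_nonpos (a := 0 - u' w) (by linarith)]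
          norm_num
        · rw [hdecomp v, hdecomp w]; simp [hv, hw]
      have hsum : ∑ v, u v = t * S.card + ∑ v, u' v := by
        rw [Finset.sum_congr rfl fun v _ => hdecomp v, Finset.sum_add_distrib, ← Finset.mul_sum]
        simp
      have htv : ∑ v, ∑ w, A v w * |u v - u w|
          = t * (2 * ∑ v ∈ S, ∑ w ∈ Sᶜ, A v w) + ∑ v, ∑ w, A v w * |u' v - u' w| := by
        rw [← sum_abs_indicator_sub_eq_cut hA, Finset.mul_sum, ← Finset.sum_add_distrib]
        refine Finset.sum_congr rfl fun v _ => ?_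
        rw [Finset.mul_sum, ← Finset.sum_add_distrib]
        refine Finset.sum_congr rfl fun w _ => ?_
        rw [habs]; ring
      rw [hsum, htv]
      nlinarith [mul_le_mul_of_nonneg_left hcut ht.le]

lemma exists_median [Nonempty V] (f : V → ℝ) :
    ∃ m, 2 * (Finset.univ.filter fun v => m < f v).card ≤ Fintype.card V ∧
      2 * (Finset.univ.filter fun v => f v < m).card ≤ Fintype.card V := by
  set T := Finset.univ.filter fun v =>
    2 * (Finset.univ.filter fun w => f v < f w).card ≤ Fintype.card V with hT
  have hTne : T.Nonempty := by
    obtain ⟨v, -, hv⟩ := Finset.univ.exists_max_image f Finset.univ_nonempty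
    refine ⟨v, ?_⟩
    have : (Finset.univ.filter fun w => f v < f w) = ∅ :=
      Finset.filter_eq_empty_iff.2 fun w hw => not_lt.2 (hv w hw)
    simp [hT, this]
  obtain ⟨v, hvT, hmin⟩ := T.exists_min_image f hTne
  refine ⟨f v, by simpa [hT] using hvT, ?_⟩
  set U := Finset.univ.filter fun w => f w < f v with hU
  rcases U.eq_empty_or_nonempty with hemp | hne
  · simp [hemp]
  · obtain ⟨x, hxU, hmax⟩ := U.exists_max_image f hne
    -- The median is the least value with at most half of the vertices strictly above it. The next
    -- smaller value `f x` fails this, so more than half of the vertices lie strictly above `f x`,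
    -- and these are disjoint from `U`.
    have hxT : x ∉ T := fun hx => by
      have := hmin x hx
      have h2 : f x < f v := by simpa [hU] using hxU
      linarith
    have hlt : Fintype.card V < 2 * (Finset.univ.filter fun w => f x < f w).card := by
      simpa [hT] using hxT
    have hdisj : Disjoint U (Finset.univ.filter fun w => f x < f w) := by
      rw [Finset.disjoint_left]
      intro w hw hw'
      exact absurd (hmax w hw) (not_le.2 (by simpa using hw'))
    have := Finset.card_le_univ (U ∪ Finset.univ.filter fun w => f x < f w)
    rw [Finset.card_union_of_disjoint hdisj] at this
    lia

/-- The coarea bound for `g²`, followed by Cauchy–Schwarz for the factorization `|g v² - g w²| = |g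
v - g w| (g v + g w)`. -/
lemma IsExpanding.sq_mul_sum_sq_le (hexp : IsExpanding A h) (hA : A.IsSymm)
    (hA0 : ∀ v w, 0 ≤ A v w) (hh : 0 ≤ h) {D : ℝ} (hD : ∀ v, ∑ w, A v w ≤ D) (g : V → ℝ)
    (hg : ∀ v, 0 ≤ g v)
    (hsupp : 2 * (Finset.univ.filter fun v => 0 < g v).card ≤ Fintype.card V) :
    h ^ 2 * ∑ v, g v ^ 2 ≤ 2 * D * dirichletForm A g := by
  have hsupp' : (Finset.univ.filter fun v => 0 < g v ^ 2) = Finset.univ.filter fun v => 0 < g v :=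
    Finset.filter_congr fun v _ => by
      constructor
      · intro h0
        exact lt_of_le_of_ne (hg v) (fun h1 => by simp [← h1] at h0)
      · intro h0
        positivity
  have h1 := hexp.mul_sum_le hA (fun v => g v ^ 2) (fun v => sq_nonneg _) (by rwa [hsupp'])
  have hCS : (∑ v, ∑ w, A v w * |g v ^ 2 - g w ^ 2|) ^ 2 ≤
      (∑ v, ∑ w, A v w * (g v - g w) ^ 2) * ∑ v, ∑ w, A v w * (g v + g w) ^ 2 := by
    simp only [← Finset.sum_product']
    refine Finset.sum_sq_le_sum_mul_sum_of_sq_le_mul _ (fun x _ => ?_) (fun x _ => ?_) fun x _ => ?_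
    · exact mul_nonneg (hA0 _ _) (sq_nonneg _)
    · exact mul_nonneg (hA0 _ _) (sq_nonneg _)
    · rw [mul_pow, sq_abs]
      exact le_of_eq (by ring)
  have hplus : ∑ v, ∑ w, A v w * (g v + g w) ^ 2 ≤ 4 * D * ∑ v, g v ^ 2 := by
    have hle : ∑ v, ∑ w, A v w * (g v + g w) ^ 2 ≤
        ∑ v, ∑ w, (2 * (A v w * g v ^ 2) + 2 * (A v w * g w ^ 2)) :=
      Finset.sum_le_sum fun v _ => Finset.sum_le_sum fun w _ => by
        nlinarith [mul_nonneg (hA0 v w) (sq_nonneg (g v - g w))]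
    have h2 : ∑ v, ∑ w, A v w * g v ^ 2 ≤ D * ∑ v, g v ^ 2 := by
      rw [Finset.mul_sum]
      refine Finset.sum_le_sum fun v _ => ?_
      rw [← Finset.sum_mul]
      exact mul_le_mul_of_nonneg_right (hD v) (sq_nonneg _)
    have h3 : ∑ v, ∑ w, A v w * g w ^ 2 = ∑ v, ∑ w, A v w * g v ^ 2 := by
      rw [Finset.sum_comm]
      exact Finset.sum_congr rfl fun v _ => Finset.sum_congr rfl fun w _ => by rw [hA.apply]
    simp only [Finset.sum_add_distrib, ← Finset.mul_sum] at hle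
    linarith
  have hE : ∑ v, ∑ w, A v w * (g v - g w) ^ 2 = 2 * dirichletForm A g := by
    unfold dirichletForm; ring
  have hE0 : 0 ≤ dirichletForm A g := by
    unfold dirichletForm
    exact div_nonneg (Finset.sum_nonneg fun v _ => Finset.sum_nonneg fun w _ =>
      mul_nonneg (hA0 _ _) (sq_nonneg _)) (by norm_num)
  rw [hE] at hCS
  set s := ∑ v, g v ^ 2 with hs
  have hs0 : 0 ≤ s := Finset.sum_nonneg fun v _ => sq_nonneg _
  rcases hs0.eq_or_lt with h0 | hspos
  · rcases isEmpty_or_nonempty V with hV | ⟨⟨v⟩⟩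
    · simp [hs, dirichletForm]
    · have hD0 : 0 ≤ D := (Finset.sum_nonneg fun w _ => hA0 v w).trans (hD v)
      rw [← h0, mul_zero]
      positivity
  · have h4 : (2 * (h * s)) ^ 2 ≤ 2 * dirichletForm A g * (4 * D * s) := by
      refine le_trans ?_ (hCS.trans (mul_le_mul_of_nonneg_left hplus (by positivity)))
      exact pow_le_pow_left₀ (by positivity) (by linarith) 2
    refine le_of_mul_le_mul_right ?_ hspos
    nlinarith

/-- Cheeger's inequality. -/
lemma IsExpanding.cheeger (hexp : IsExpanding A h) (hA : A.IsSymm)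
    (hA0 : ∀ v w, 0 ≤ A v w) (hh : 0 ≤ h) {D : ℝ} (hD0 : 0 < D) (hD : ∀ v, ∑ w, A v w ≤ D)
    (f : V → ℝ) (hf : ∑ v, (∑ w, A v w) * f v = 0) :
    h ^ 2 / (2 * D ^ 2) * ∑ v, (∑ w, A v w) * f v ^ 2 ≤ dirichletForm A f := by
  rcases isEmpty_or_nonempty V with hV | hV
  · simp [dirichletForm]
  -- The positive and negative parts of `f - m` are each supported on at most half of the vertices,
  -- and their Dirichlet forms add up to at most that of `f`.
  obtain ⟨m, hm1, hm2⟩ := exists_median f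
  have hp := hexp.sq_mul_sum_sq_le hA hA0 hh hD (fun v => max (f v - m) 0)
    (fun v => le_max_right _ _) (by simpa using hm1)
  have hn := hexp.sq_mul_sum_sq_le hA hA0 hh hD (fun v => max (m - f v) 0)
    (fun v => le_max_right _ _) (by simpa using hm2)
  have hsq : ∀ v, (f v - m) ^ 2 = max (f v - m) 0 ^ 2 + max (m - f v) 0 ^ 2 := fun v => by
    rcases le_total (f v) m with hv | hv
    · rw [max_eq_right (by linarith), max_eq_left (by linarith)]; ring
    · rw [max_eq_left (by linarith), max_eq_right (by linarith)]; ring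
  have hform : dirichletForm A (fun v => max (f v - m) 0)
      + dirichletForm A (fun v => max (m - f v) 0)
      ≤ dirichletForm A f := by
    unfold dirichletForm
    rw [← add_div, ← Finset.sum_add_distrib]
    refine div_le_div_of_nonneg_right (Finset.sum_le_sum fun v _ => ?_) (by norm_num)
    rw [← Finset.sum_add_distrib]
    refine Finset.sum_le_sum fun w _ => ?_
    rw [← mul_add]
    refine mul_le_mul_of_nonneg_left ?_ (hA0 v w)
    beta_reduce
    rcases le_total (f v) m with hv | hv <;> rcases le_total (f w) m with hw | hw
    · rw [max_eq_right (by linarith : f v - m ≤ 0), max_eq_left (by linarith : 0 ≤ m - f v),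
        max_eq_right (by linarith : f w - m ≤ 0), max_eq_left (by linarith : 0 ≤ m - f w)]
      nlinarith
    · rw [max_eq_right (by linarith : f v - m ≤ 0), max_eq_left (by linarith : 0 ≤ m - f v),
        max_eq_left (by linarith : 0 ≤ f w - m), max_eq_right (by linarith : m - f w ≤ 0)]
      nlinarith [mul_nonneg (sub_nonneg.2 hv) (sub_nonneg.2 hw)]
    · rw [max_eq_left (by linarith : 0 ≤ f v - m), max_eq_right (by linarith : m - f v ≤ 0),
        max_eq_right (by linarith : f w - m ≤ 0), max_eq_left (by linarith : 0 ≤ m - f w)]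
      nlinarith [mul_nonneg (sub_nonneg.2 hv) (sub_nonneg.2 hw)]
    · rw [max_eq_left (by linarith : 0 ≤ f v - m), max_eq_right (by linarith : m - f v ≤ 0),
        max_eq_left (by linarith : 0 ≤ f w - m), max_eq_right (by linarith : m - f w ≤ 0)]
      nlinarith
  -- As `f` has weighted mean zero, shifting it by `m` can only increase its weighted second moment.
  have hmean : ∑ v, (∑ w, A v w) * f v ^ 2 ≤ D * ∑ v, (f v - m) ^ 2 := by
    have h1 : ∑ v, (∑ w, A v w) * (f v - m) ^ 2 =
        ∑ v, (∑ w, A v w) * f v ^ 2 - 2 * m * ∑ v, (∑ w, A v w) * f v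
          + m ^ 2 * ∑ v, ∑ w, A v w := by
      simp only [Finset.mul_sum (s := Finset.univ) (a := 2 * m),
        Finset.mul_sum (s := Finset.univ) (a := m ^ 2) (f := fun v => ∑ w, A v w)]
      rw [← Finset.sum_sub_distrib, ← Finset.sum_add_distrib]
      exact Finset.sum_congr rfl fun v _ => by ring
    have h2 : ∑ v, (∑ w, A v w) * (f v - m) ^ 2 ≤ D * ∑ v, (f v - m) ^ 2 := by
      rw [Finset.mul_sum]
      exact Finset.sum_le_sum fun v _ => mul_le_mul_of_nonneg_right (hD v) (sq_nonneg _)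
    have h3 : 0 ≤ m ^ 2 * ∑ v, ∑ w, A v w :=
      mul_nonneg (sq_nonneg _) (Finset.sum_nonneg fun v _ => Finset.sum_nonneg fun w _ => hA0 v w)
    rw [hf] at h1
    linarith
  have hsum : ∑ v, (f v - m) ^ 2 = ∑ v, max (f v - m) 0 ^ 2 + ∑ v, max (m - f v) 0 ^ 2 := by
    rw [← Finset.sum_add_distrib]
    exact Finset.sum_congr rfl fun v _ => hsq v
  rw [div_mul_eq_mul_div, div_le_iff₀ (by positivity)]
  have h5 : h ^ 2 * ∑ v, (f v - m) ^ 2 ≤ 2 * D * dirichletForm A f := by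
    rw [hsum, mul_add]
    nlinarith [mul_le_mul_of_nonneg_left hform hD0.le]
  nlinarith [mul_le_mul_of_nonneg_left hmean (sq_nonneg h), mul_le_mul_of_nonneg_left h5 hD0.le]

end WeightedGraph

/-! ### The trace of the fundamental matrix and mean hitting times -/

section Kemeny

variable {V : Type*} [Fintype V] {A : Matrix V V ℝ}

lemma sum_mul_mulVec_eq_dirichletForm (hA : A.IsSymm) (f : V → ℝ) :
    ∑ v, (∑ w, A v w) * f v ^ 2 - ∑ v, ∑ w, A v w * f v * f w = dirichletForm A f := by
  have h1 : ∑ v, ∑ w, A v w * f w ^ 2 = ∑ v, (∑ w, A v w) * f v ^ 2 := by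
    rw [Finset.sum_comm]
    refine Finset.sum_congr rfl fun v _ => ?_
    rw [Finset.sum_mul]
    exact Finset.sum_congr rfl fun w _ => by rw [hA.apply]
  have h2 : ∑ v, ∑ w, A v w * (f v - f w) ^ 2 = ∑ v, (∑ w, A v w) * f v ^ 2
      - 2 * ∑ v, ∑ w, A v w * f v * f w + ∑ v, ∑ w, A v w * f w ^ 2 := by
    simp only [Finset.sum_mul, Finset.mul_sum, ← Finset.sum_add_distrib, ← Finset.sum_sub_distrib]
    exact Finset.sum_congr rfl fun v _ => Finset.sum_congr rfl fun w _ => by ring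
  unfold dirichletForm
  rw [h2, h1]
  ring

variable [DecidableEq V]

/-- For `y = Z f` the lower bound on `M` reads `g ‖y‖² ≤ ⟨y, f⟩`; combine it with `⟨f, y⟩² ≤ ‖f‖²
‖y‖²`. -/
lemma weighted_inner_inverse_bounds {M Z : Matrix V V ℝ} {d : V → ℝ} (hd : ∀ v, 0 < d v)
    (hZ : M * Z = 1) {g : ℝ} (hg : 0 < g)
    (hM : ∀ f : V → ℝ, g * ∑ v, d v * f v ^ 2 ≤ ∑ v, d v * f v * (M.mulVec f) v) (f : V → ℝ) :
    0 ≤ ∑ v, d v * f v * (Z.mulVec f) v ∧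
      ∑ v, d v * f v * (Z.mulVec f) v ≤ (∑ v, d v * f v ^ 2) / g := by
  set y := Z.mulVec f with hy
  have hMy : M.mulVec y = f := by rw [hy, Matrix.mulVec_mulVec, hZ, Matrix.one_mulVec]
  have h1 := hM y
  rw [hMy] at h1
  have hcomm : ∑ v, d v * y v * f v = ∑ v, d v * f v * y v :=
    Finset.sum_congr rfl fun v _ => by ring
  rw [hcomm] at h1
  have hy0 : 0 ≤ ∑ v, d v * y v ^ 2 :=
    Finset.sum_nonneg fun v _ => mul_nonneg (hd v).le (sq_nonneg _)
  have hs0 : 0 ≤ ∑ v, d v * f v * y v := (mul_nonneg hg.le hy0).trans h1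
  refine ⟨hs0, ?_⟩
  have hCS : (∑ v, d v * f v * y v) ^ 2 ≤ (∑ v, d v * f v ^ 2) * ∑ v, d v * y v ^ 2 :=
    Finset.sum_sq_le_sum_mul_sum_of_sq_le_mul _
      (fun v _ => mul_nonneg (hd v).le (sq_nonneg _))
      (fun v _ => mul_nonneg (hd v).le (sq_nonneg _)) fun v _ => le_of_eq (by ring)
  have hf0 : 0 ≤ ∑ v, d v * f v ^ 2 :=
    Finset.sum_nonneg fun v _ => mul_nonneg (hd v).le (sq_nonneg _)
  rw [le_div_iff₀ hg]
  rcases hs0.eq_or_lt with h0 | hpos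
  · rw [← h0, zero_mul]; exact hf0
  · refine le_of_mul_le_mul_right ?_ hpos
    nlinarith [mul_le_mul_of_nonneg_left h1 hf0, mul_le_mul_of_nonneg_left hCS hg.le]

/-- Bounds on the trace of the inverse of a matrix that is self-adjoint and bounded below by `g`
for the inner product with weights `d`. -/
lemma trace_inverse_bounds {M Z : Matrix V V ℝ} {d : V → ℝ} (hd : ∀ v, 0 < d v)
    (hMd : ∀ v w, d v * M v w = d w * M w v) (hZ : M * Z = 1) {g : ℝ} (hg : 0 < g)
    (hM : ∀ f : V → ℝ, g * ∑ v, d v * f v ^ 2 ≤ ∑ v, d v * f v * (M.mulVec f) v) :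
    2 * Fintype.card V - M.trace ≤ Z.trace ∧
      Z.trace ≤ 2 * Fintype.card V - M.trace + ((1 - M) * (1 - M)).trace / g := by
  have hZ' : Z * M = 1 := mul_eq_one_comm.1 hZ
  set C := 1 - M with hC
  have hCd : ∀ v w, d v * C v w = d w * C w v := fun v w => by
    rw [hC, Matrix.sub_apply, Matrix.sub_apply, mul_sub, mul_sub, hMd v w]
    by_cases hvw : v = w
    · rw [hvw]
    · rw [Matrix.one_apply_ne hvw, Matrix.one_apply_ne (Ne.symm hvw)]; simp
  have hexpand : C * (Z * C) = Z - 2 + M := by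
    rw [hC, mul_sub, mul_one, hZ', sub_mul, one_mul, mul_sub, hZ, mul_one]
    rw [← one_add_one_eq_two]
    abel
  have htr : (C * (Z * C)).trace = Z.trace - 2 * Fintype.card V + M.trace := by
    rw [hexpand, Matrix.trace_add, Matrix.trace_sub, ← one_add_one_eq_two, Matrix.trace_add,
      Matrix.trace_one]
    ring
  -- Self-adjointness of `C` turns a diagonal entry of `C Z C` into the quadratic form of `Z` at a
  -- column of `C`.
  have hdiag : ∀ v, (C * (Z * C)) v v
      = (∑ w, d w * C w v * (Z.mulVec fun u => C u v) w) / d v := fun v => by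
    rw [eq_div_iff (hd v).ne', Matrix.mul_apply, Finset.sum_mul]
    refine Finset.sum_congr rfl fun w _ => ?_
    rw [← hCd v w, Matrix.mul_apply]
    simp only [Matrix.mulVec, dotProduct]
    ring
  have hdiag2 : ∀ v, (C * C) v v = (∑ w, d w * C w v ^ 2) / d v := fun v => by
    rw [eq_div_iff (hd v).ne', Matrix.mul_apply, Finset.sum_mul]
    refine Finset.sum_congr rfl fun w _ => ?_
    rw [pow_two, ← mul_assoc, ← hCd v w]
    ring
  have hb := fun v => weighted_inner_inverse_bounds hd hZ hg hM (fun u => C u v)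
  have h0 : 0 ≤ (C * (Z * C)).trace :=
    Finset.sum_nonneg fun v _ => by
      rw [Matrix.diag_apply, hdiag]
      exact div_nonneg (hb v).1 (hd v).le
  have h1 : (C * (Z * C)).trace ≤ (C * C).trace / g := by
    rw [Matrix.trace, Matrix.trace, Finset.sum_div]
    refine Finset.sum_le_sum fun v _ => ?_
    rw [Matrix.diag_apply, Matrix.diag_apply, hdiag, hdiag2, div_right_comm]
    exact div_le_div_of_nonneg_right (hb v).2 (hd v).le
  rw [htr] at h0 h1
  constructor <;> linarith

/-- The matrix `I - P + 1 πᵀ` of the random walk on the weighted graph `A`. Its inverse is the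
fundamental matrix of the walk. -/
noncomputable def fundamental (A : Matrix V V ℝ) : Matrix V V ℝ :=
  Matrix.of fun v w => (1 : Matrix V V ℝ) v w - A v w / (∑ u, A v u)
    + (∑ u, A w u) / ∑ x, ∑ u, A x u

lemma fundamental_mulVec (f : V → ℝ) (v : V) :
    (fundamental A).mulVec f v = f v - (∑ w, A v w * f w) / (∑ u, A v u)
      + (∑ w, (∑ u, A w u) * f w) / ∑ x, ∑ u, A x u := by
  simp only [Matrix.mulVec, dotProduct, fundamental, Matrix.of_apply, add_mul, sub_mul,
    Finset.sum_add_distrib, Finset.sum_sub_distrib, Matrix.one_apply, ite_mul, one_mul, zero_mul,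
    Finset.sum_ite_eq, Finset.mem_univ, if_true]
  rw [Finset.sum_div (f := fun w => A v w * f w),
    Finset.sum_div (f := fun w => (∑ u, A w u) * f w)]
  congr 1
  · congr 1
    exact Finset.sum_congr rfl fun w _ => by ring
  · exact Finset.sum_congr rfl fun w _ => by ring

/-- The form splits into the Dirichlet form plus `s² / vol`. The gap controls the centred part of
`f`; the rank-one term controls the constant part, which is where `g ≤ 1` enters. -/
lemma fundamental_quadratic_form [Nonempty V] (hA : A.IsSymm) (hd : ∀ v, 0 < ∑ w, A v w)
    {g : ℝ} (hg1 : g ≤ 1)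
    (hgap : ∀ f : V → ℝ, ∑ v, (∑ w, A v w) * f v = 0 →
      g * ∑ v, (∑ w, A v w) * f v ^ 2 ≤ dirichletForm A f) (f : V → ℝ) :
    g * ∑ v, (∑ w, A v w) * f v ^ 2
      ≤ ∑ v, (∑ w, A v w) * f v * ((fundamental A).mulVec f) v := by
  set vol := ∑ x, ∑ u, A x u with hvol
  have hvol0 : 0 < vol := Finset.sum_pos (fun v _ => hd v) Finset.univ_nonempty
  set s := ∑ v, (∑ w, A v w) * f v with hs
  have hform : ∑ v, (∑ w, A v w) * f v * ((fundamental A).mulVec f) v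
      = dirichletForm A f + s ^ 2 / vol := by
    rw [← sum_mul_mulVec_eq_dirichletForm hA, pow_two, mul_div_assoc, hs, Finset.sum_mul,
      ← Finset.sum_sub_distrib, ← Finset.sum_add_distrib]
    refine Finset.sum_congr rfl fun v _ => ?_
    have h1 : ∑ w, A v w * f v * f w = f v * ∑ w, A v w * f w := by
      rw [Finset.mul_sum]
      exact Finset.sum_congr rfl fun w _ => by ring
    rw [fundamental_mulVec, h1, ← hvol]
    field_simp [(hd v).ne']
  have hcent := hgap (fun v => f v - s / vol) (by
    simp only [mul_sub, Finset.sum_sub_distrib, ← Finset.sum_mul]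
    rw [← hs, ← hvol]
    field_simp
    ring)
  have hdir : dirichletForm A (fun v => f v - s / vol) = dirichletForm A f := by
    simp [dirichletForm]
  have hvar : ∑ v, (∑ w, A v w) * (f v - s / vol) ^ 2
      = ∑ v, (∑ w, A v w) * f v ^ 2 - s ^ 2 / vol := by
    have h2 : ∑ v, (∑ w, A v w) * (f v - s / vol) ^ 2 = ∑ v, (∑ w, A v w) * f v ^ 2
        - 2 * (s / vol) * s + (s / vol) ^ 2 * vol := by
      rw [hs, hvol, Finset.mul_sum (s := Finset.univ) (a := 2 * _), Finset.mul_sum (a := _ ^ 2),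
        ← Finset.sum_sub_distrib, ← Finset.sum_add_distrib]
      exact Finset.sum_congr rfl fun v _ => by ring
    rw [h2]
    field_simp
    ring
  rw [hdir, hvar] at hcent
  rw [hform]
  have : 0 ≤ s ^ 2 / vol := by positivity
  nlinarith

lemma exists_fundamental_inverse [Nonempty V] (hA : A.IsSymm) (hd : ∀ v, 0 < ∑ w, A v w)
    {g : ℝ} (hg : 0 < g) (hg1 : g ≤ 1)
    (hgap : ∀ f : V → ℝ, ∑ v, (∑ w, A v w) * f v = 0 →
      g * ∑ v, (∑ w, A v w) * f v ^ 2 ≤ dirichletForm A f) :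
    ∃ Z, fundamental A * Z = 1 := by
  have hinj : Function.Injective (fundamental A).mulVec := by
    intro x y hxy
    have h0 : (fundamental A).mulVec (x - y) = 0 := by
      rw [Matrix.mulVec_sub]
      exact sub_eq_zero.2 hxy
    have h1 := fundamental_quadratic_form hA hd hg1 hgap (x - y)
    rw [h0] at h1
    simp only [Pi.zero_apply, mul_zero, Finset.sum_const_zero] at h1
    have hnn : ∀ v ∈ Finset.univ, 0 ≤ (∑ w, A v w) * (x - y) v ^ 2 :=
      fun v _ => mul_nonneg (hd v).le (sq_nonneg _)
    have h2 : ∑ v, (∑ w, A v w) * (x - y) v ^ 2 = 0 :=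
      le_antisymm (nonpos_of_mul_nonpos_right h1 hg) (Finset.sum_nonneg hnn)
    funext v
    have h3 := (Finset.sum_eq_zero_iff_of_nonneg hnn).1 h2 v (Finset.mem_univ v)
    have h4 : (x - y) v = 0 := by simpa [(hd v).ne'] using h3
    simpa [sub_eq_zero] using h4
  exact ⟨_, Matrix.mul_nonsing_inv _
    ((Matrix.isUnit_iff_isUnit_det _).1 (Matrix.mulVec_injective_iff_isUnit.1 hinj))⟩

lemma trace_fundamental [Nonempty V] (hd : ∀ v, 0 < ∑ w, A v w) :
    (fundamental A).trace = Fintype.card V - ∑ v, A v v / (∑ u, A v u) + 1 := by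
  have hvol0 : 0 < ∑ x, ∑ u, A x u := Finset.sum_pos (fun v _ => hd v) Finset.univ_nonempty
  simp only [Matrix.trace, Matrix.diag_apply, fundamental, Matrix.of_apply,
    Finset.sum_add_distrib, Finset.sum_sub_distrib, Matrix.one_apply_eq, ← Finset.sum_div]
  rw [div_self hvol0.ne']
  simp

lemma trace_sq_one_sub_fundamental [Nonempty V] (hA : A.IsSymm) (hd : ∀ v, 0 < ∑ w, A v w) :
    ((1 - fundamental A) * (1 - fundamental A)).trace
      = ∑ v, ∑ w, A v w ^ 2 / ((∑ u, A v u) * ∑ u, A w u) - 1 := by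
  set vol := ∑ x, ∑ u, A x u with hvol
  have hvol0 : 0 < vol := Finset.sum_pos (fun v _ => hd v) Finset.univ_nonempty
  have hentry : ∀ v w, (1 - fundamental A) v w * (1 - fundamental A) w v
      = A v w ^ 2 / ((∑ u, A v u) * ∑ u, A w u) - 2 / vol * A v w
        + (∑ u, A v u) * (∑ u, A w u) / vol ^ 2 - 0 := fun v w => by
    have h1 := (hd v).ne'
    have h2 := (hd w).ne'
    simp only [fundamental, Matrix.sub_apply, Matrix.of_apply, ← hvol]
    rw [hA.apply v w]
    field_simp
    ring
  simp only [Matrix.trace, Matrix.diag_apply, Matrix.mul_apply]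
  simp only [hentry, Finset.sum_sub_distrib, Finset.sum_add_distrib, ← Finset.mul_sum,
    ← Finset.sum_div, ← Finset.sum_mul, sub_zero]
  rw [← hvol]
  field_simp
  ring

/-- Mean hitting times of the random walk on a weighted graph with spectral gap at least `g` and
weighted degrees at least `h`, and bounds for their average over the target. -/
lemma exists_mean_hitting_times [Nonempty V] (hA : A.IsSymm) (hA0 : ∀ v w, 0 ≤ A v w)
    (hA1 : ∀ v w, A v w ≤ 1) {h : ℝ} (hh : 0 < h) (hd : ∀ v, h ≤ ∑ w, A v w)
    {g : ℝ} (hg : 0 < g) (hg1 : g ≤ 1)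
    (hgap : ∀ f : V → ℝ, ∑ v, (∑ w, A v w) * f v = 0 →
      g * ∑ v, (∑ w, A v w) * f v ^ 2 ≤ dirichletForm A f) :
    ∃ H : V → V → ℝ, (∀ w, H w w = 0) ∧
      (∀ v w, v ≠ w → H v w = 1 + (∑ u, A v u * H u w) / ∑ u, A v u) ∧
      ∀ v, (Fintype.card V : ℝ) - 2 ≤ ∑ w, (∑ u, A w u) / (∑ x, ∑ u, A x u) * H v w ∧
        ∑ w, (∑ u, A w u) / (∑ x, ∑ u, A x u) * H v w
          ≤ Fintype.card V * (1 + 1 / h + 1 / (h * g)) := by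
  have hd0 : ∀ v, 0 < ∑ w, A v w := fun v => hh.trans_le (hd v)
  have hsymm : ∀ u, ∑ v, A v u = ∑ v, A u v := fun u =>
    Finset.sum_congr rfl fun v _ => hA.apply u v
  obtain ⟨Z, hZ⟩ := exists_fundamental_inverse hA hd0 hg hg1 hgap
  have hZ' : Z * fundamental A = 1 := mul_eq_one_comm.1 hZ
  have htrace := trace_inverse_bounds (M := fundamental A) hd0 (fun v w => by
    have h1 := (hd0 v).ne'
    have h2 := (hd0 w).ne'
    simp only [fundamental, Matrix.of_apply, hA.apply v w]
    by_cases hvw : v = w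
    · rw [hvw]
    · rw [Matrix.one_apply_ne hvw, Matrix.one_apply_ne (Ne.symm hvw)]
      field_simp
      ring) hZ hg (fundamental_quadratic_form hA hd0 hg1 hgap)
  rw [trace_fundamental hd0, trace_sq_one_sub_fundamental hA hd0] at htrace
  set vol := ∑ x, ∑ u, A x u with hvol
  have hvol0 : 0 < vol := Finset.sum_pos (fun v _ => hd0 v) Finset.univ_nonempty
  have hrow : ∀ v, ∑ w, Z v w = 1 := by
    have h1 : (fundamental A).mulVec 1 = 1 := by
      funext v
      rw [fundamental_mulVec, ← hvol]
      simp only [Pi.one_apply, mul_one]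
      rw [div_self (hd0 v).ne', ← hvol, div_self hvol0.ne']
      ring
    have h2 : Z.mulVec 1 = 1 := by
      conv_lhs => rw [← h1, Matrix.mulVec_mulVec, hZ', Matrix.one_mulVec]
    intro v
    have h3 := congrFun h2 v
    simpa [Matrix.mulVec, dotProduct] using h3
  have hcol : ∀ w, ∑ v, (∑ u, A v u) * Z v w = ∑ u, A w u := by
    have h1 : Matrix.vecMul (fun v => ∑ u, A v u) (fundamental A) = fun v => ∑ u, A v u := by
      funext w
      have hterm : ∀ v, (∑ u, A v u) * fundamental A v w
          = (∑ u, A v u) * (1 : Matrix V V ℝ) v w - A v w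
            + (∑ u, A v u) * ((∑ u, A w u) / vol) := fun v => by
        have := (hd0 v).ne'
        simp only [fundamental, Matrix.of_apply, ← hvol]
        field_simp
      simp only [Matrix.vecMul, dotProduct, hterm, Finset.sum_add_distrib, Finset.sum_sub_distrib,
        ← Finset.sum_mul, Matrix.one_apply, mul_ite, mul_one, mul_zero, Finset.sum_ite_eq',
        Finset.mem_univ, if_true]
      rw [← hvol, hsymm w]
      field_simp
      ring
    have h2 : Matrix.vecMul (fun v => ∑ u, A v u) Z = fun v => ∑ u, A v u := by
      conv_lhs => rw [← h1, Matrix.vecMul_vecMul, hZ, Matrix.vecMul_one]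
    intro w
    have h3 := congrFun h2 w
    simpa [Matrix.vecMul, dotProduct] using h3
  -- The classical formula `H v w = (Z w w - Z v w) / π w`, with `π w` the weighted degree of `w`
  -- over the volume.
  refine ⟨fun v w => (Z w w - Z v w) * vol / ∑ u, A w u, fun w => by simp, fun v w hvw => ?_,
    fun v => ?_⟩
  · have h1 : (fundamental A * Z) v w = 0 := by rw [hZ, Matrix.one_apply_ne hvw]
    have h2 : (fundamental A).mulVec (fun u => Z u w) v = 0 := by
      rw [← h1, Matrix.mul_apply]; rfl
    rw [fundamental_mulVec, hcol, ← hvol] at h2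
    have h3 : ∑ u, A v u * ((Z w w - Z u w) * vol / ∑ x, A w x)
        = ((∑ u, A v u) * Z w w - ∑ u, A v u * Z u w) * (vol / ∑ x, A w x) := by
      rw [Finset.sum_mul, ← Finset.sum_sub_distrib, Finset.sum_mul]
      exact Finset.sum_congr rfl fun u _ => by ring
    rw [h3]
    have h4 := (hd0 v).ne'
    have h5 := (hd0 w).ne'
    field_simp at h2 ⊢
    linear_combination (-1) * h2
  · have h1 : ∑ w, (∑ u, A w u) / vol * ((Z w w - Z v w) * vol / ∑ u, A w u) = Z.trace - 1 := by
      rw [← hrow v, Matrix.trace, ← Finset.sum_sub_distrib]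
      refine Finset.sum_congr rfl fun w _ => ?_
      have h5 := (hd0 w).ne'
      rw [Matrix.diag_apply]
      field_simp
    beta_reduce
    rw [h1]
    have hP0 : 0 ≤ ∑ v, A v v / (∑ u, A v u) :=
      Finset.sum_nonneg fun v _ => div_nonneg (hA0 v v) (hd0 v).le
    have hP1 : ∑ v, A v v / (∑ u, A v u) ≤ Fintype.card V * (1 / h) := by
      rw [← nsmul_eq_mul]
      refine Finset.sum_le_card_nsmul _ _ _ fun v _ => ?_
      exact div_le_div₀ zero_le_one (hA1 v v) hh (hd v)
    have hP2 : ∑ v, ∑ w, A v w ^ 2 / ((∑ u, A v u) * ∑ u, A w u) ≤ Fintype.card V * (1 / h) := by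
      rw [← nsmul_eq_mul]
      -- Weights in `[0, 1]` satisfy `A² ≤ A`; bounding one degree below by `h` leaves a row of `P`,
      -- whose sum is 1.
      refine Finset.sum_le_card_nsmul _ _ _ fun v _ => ?_
      calc ∑ w, A v w ^ 2 / ((∑ u, A v u) * ∑ u, A w u)
          ≤ ∑ w, A v w / ((∑ u, A v u) * h) := by
            refine Finset.sum_le_sum fun w _ => ?_
            refine div_le_div₀ (hA0 v w) ?_ (mul_pos (hd0 v) hh)
              (mul_le_mul_of_nonneg_left (hd w) (hd0 v).le)
            nlinarith [hA0 v w, hA1 v w]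
        _ = 1 / h := by
            rw [← Finset.sum_div, div_mul_eq_div_div, div_self (hd0 v).ne']
    refine ⟨by linarith [htrace.1], ?_⟩
    have h6 : (∑ v, ∑ w, A v w ^ 2 / ((∑ u, A v u) * ∑ u, A w u) - 1) / g
        ≤ Fintype.card V * (1 / (h * g)) := by
      rw [div_mul_eq_div_div, ← mul_div_assoc]
      exact div_le_div_of_nonneg_right (by linarith) hg.le
    linarith [htrace.2]

end Kemeny

/-! ### Expected hitting times of the walk as solutions of a linear system -/

section HittingTime

variable {V : Type*}

/-- The adjacency matrix. -/
def adjacency (ε : Sym2 V → Bool) : Matrix V V ℝ :=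
  Matrix.of fun v w => if ε s(v, w) = true then 1 else 0

lemma adjacency_isSymm (ε : Sym2 V → Bool) : (adjacency ε).IsSymm := by
  ext v w
  simp [adjacency, Sym2.eq_swap]

lemma adjacency_nonneg (ε : Sym2 V → Bool) (v w : V) : 0 ≤ adjacency ε v w := by
  simp only [adjacency, Matrix.of_apply]
  split_ifs <;> norm_num

lemma adjacency_le_one (ε : Sym2 V → Bool) (v w : V) : adjacency ε v w ≤ 1 := by
  simp only [adjacency, Matrix.of_apply]
  split_ifs <;> norm_num

-- The tail-sum formula: the hitting time counts the times `t` up to which `w` has been avoided.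
open Classical in
lemma firstHit_eq_tsum (w : V) (x : ℕ → V) :
    firstHit w x = ∑' t, if ∀ s ≤ t, x s ≠ w then (1 : ℝ≥0∞) else 0 := by
  by_cases hx : ∃ t, x t = w
  · have h1 : firstHit w x = Nat.find hx := by
      refine le_antisymm 
        (iInf₂_le (f := fun t (_ : x t = w) => (t : ℝ≥0∞)) _ (Nat.find_spec hx))
        (le_iInf₂ fun t ht => ?_)
      exact_mod_cast Nat.find_min' hx ht
    have h2 : ∀ t, (∀ s ≤ t, x s ≠ w) ↔ t ∈ Finset.range (Nat.find hx) := fun t => by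
      rw [Finset.mem_range, Nat.lt_find_iff]
    rw [h1, tsum_eq_sum (s := Finset.range (Nat.find hx)) fun t ht => if_neg (mt (h2 t).1 ht),
      Finset.sum_congr rfl fun t ht => if_pos ((h2 t).2 ht)]
    simp
  · push Not at hx
    simp [firstHit, hx]

variable [Fintype V]

open Classical in
/-- One step of the walk killed in `w`, as an operator on functions on the vertices. -/
noncomputable def killedStep (ε : Sym2 V → Bool) (w : V) (g : V → ℝ≥0∞) (v : V) : ℝ≥0∞ :=
  if v = w then 0 else ∑ u, step ε v u * g u

lemma killedStep_add (ε : Sym2 V → Bool) (w : V) (g g' : V → ℝ≥0∞) :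
    killedStep ε w (g + g') = killedStep ε w g + killedStep ε w g' := by
  funext v
  by_cases hv : v = w
  · simp [killedStep, hv]
  · simp [killedStep, hv, mul_add, Finset.sum_add_distrib]

lemma killedStep_iterate_add (ε : Sym2 V → Bool) (w : V) (T : ℕ) (g g' : V → ℝ≥0∞) :
    (killedStep ε w)^[T] (g + g') = (killedStep ε w)^[T] g + (killedStep ε w)^[T] g' := by
  induction T generalizing g g' with
  | zero => rfl
  | succ T ih => rw [Function.iterate_succ_apply, killedStep_add, ih]; rfl

lemma killedStep_iterate_le (ε : Sym2 V → Bool) (w : V) (T : ℕ) {g g' : V → ℝ≥0∞} {C : ℝ≥0∞}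
    (hg : ∀ v, g v ≤ C * g' v) (v : V) :
    (killedStep ε w)^[T] g v ≤ C * (killedStep ε w)^[T] g' v := by
  induction T generalizing v with
  | zero => exact hg v
  | succ T ih =>
    rw [Function.iterate_succ_apply', Function.iterate_succ_apply']
    by_cases hv : v = w
    · simp [killedStep, hv]
    · simp only [killedStep, hv, if_false]
      rw [Finset.mul_sum]
      refine Finset.sum_le_sum fun u _ => ?_
      rw [mul_left_comm]
      exact mul_le_mul_right (ih u) _

open Classical in
/-- A finite solution of the equations for the mean hitting times of `w` is the only solution. -/
lemma tsum_killedStep_iterate_eq (ε : Sym2 V → Bool) (w : V) (k : V → ℝ≥0∞)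
    (hfin : ∀ v, k v ≠ ⊤)
    (hk : k = (fun v => if v = w then 0 else 1) + killedStep ε w k) (v : V) :
    ∑' t, (killedStep ε w)^[t] (fun v => if v = w then 0 else 1) v = k v := by
  set e : V → ℝ≥0∞ := fun v => if v = w then 0 else 1 with he
  -- Iterating the fixed-point equation leaves a remainder `(killedStep ε w)^[T] k`. It vanishes in
  -- the limit because `k` is at most a constant times `e`, whose iterates are the terms of a
  -- convergent series.
  have hpartial : ∀ T, k = (∑ t ∈ Finset.range T, (killedStep ε w)^[t] e)
      + (killedStep ε w)^[T] k := fun T => by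
    induction T with
    | zero => simp
    | succ T ih =>
      rw [Finset.sum_range_succ, add_assoc, Function.iterate_succ_apply,
        ← killedStep_iterate_add, ← hk]
      exact ih
  have hpartial' : ∀ T, k v = (∑ t ∈ Finset.range T, (killedStep ε w)^[t] e v)
      + (killedStep ε w)^[T] k v := fun T => by
    conv_lhs => rw [hpartial T]
    simp
  have hsum : ∑' t, (killedStep ε w)^[t] e v ≤ k v := by
    rw [ENNReal.tsum_eq_iSup_nat]
    exact iSup_le fun T => (hpartial' T).symm ▸ le_self_add
  have hle : ∀ u, k u ≤ (∑ x, k x) * e u := fun u => by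
    by_cases hu : u = w
    · have : k w = 0 := by
        rw [hk]; simp [he, killedStep]
      rw [hu, this]; exact zero_le
    · simpa [he, hu] using Finset.single_le_sum (f := k) (fun x _ => zero_le) (Finset.mem_univ u)
  have hC : ∑ x, k x ≠ ⊤ := ENNReal.sum_ne_top.2 fun x _ => hfin x
  have h0 : Tendsto (fun T => (killedStep ε w)^[T] e v) atTop (𝓝 0) :=
    ENNReal.tendsto_atTop_zero_of_tsum_ne_top (ne_top_of_le_ne_top (hfin v) hsum)
  have h1 : Tendsto (fun T => (killedStep ε w)^[T] k v) atTop (𝓝 0) := by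
    refine tendsto_of_tendsto_of_tendsto_of_le_of_le tendsto_const_nhds ?_ (fun T => zero_le)
      (fun T => killedStep_iterate_le ε w T hle v)
    simpa using ENNReal.Tendsto.const_mul h0 (Or.inr hC)
  have h2 := (ENNReal.tendsto_nat_tsum fun t => (killedStep ε w)^[t] e v).add h1
  rw [add_zero] at h2
  refine tendsto_nhds_unique h2 ?_
  simp only [← hpartial']
  exact tendsto_const_nhds

lemma sum_adjacency (ε : Sym2 V → Bool) (v : V) : ∑ w, adjacency ε v w = degree ε v := by
  simp [adjacency, degree, neighbors]

lemma sum_step_mul_ofReal (ε : Sym2 V → Bool) (v : V) (hv : 0 < degree ε v) (f : V → ℝ)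
    (hf : ∀ u, 0 ≤ f u) :
    ∑ u, step ε v u * ENNReal.ofReal (f u)
      = ENNReal.ofReal ((∑ u, adjacency ε v u * f u) / ∑ u, adjacency ε v u) := by
  have hne : (neighbors ε v).Nonempty := Finset.card_pos.1 hv
  rw [sum_adjacency, Finset.sum_div, ENNReal.ofReal_sum_of_nonneg]
  · refine Finset.sum_congr rfl fun u _ => ?_
    rw [step, dif_pos hne, PMF.uniformOfFinset_apply]
    by_cases hu : ε s(v, u) = true
    · rw [if_pos (by simpa [neighbors] using hu)]
      simp only [adjacency, Matrix.of_apply, hu, if_true, one_mul]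
      rw [ENNReal.ofReal_div_of_pos (by exact_mod_cast hv), ENNReal.ofReal_natCast,
        ENNReal.div_eq_inv_mul]
      rfl
    · rw [if_neg (by simpa [neighbors] using hu)]
      simp [adjacency, hu]
  · intro u _
    refine div_nonneg (mul_nonneg ?_ (hf u)) (Nat.cast_nonneg _)
    simp only [adjacency, Matrix.of_apply]
    split_ifs <;> norm_num

/-- Minimum principle. -/
lemma mean_hitting_times_nonneg [Nonempty V] (ε : Sym2 V → Bool) (hd : ∀ v, 0 < degree ε v) (w : V)
    (f : V → ℝ) (h0 : f w = 0)
    (hf : ∀ v, v ≠ w → f v = 1 + (∑ u, adjacency ε v u * f u) / ∑ u, adjacency ε v u) (v : V) :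
    0 ≤ f v := by
  obtain ⟨x, -, hx⟩ := Finset.univ.exists_min_image f Finset.univ_nonempty
  suffices h : x = w by
    have := hx v (Finset.mem_univ v)
    rwa [h, h0] at this
  by_contra hxw
  have h1 := hf x hxw
  have hdx : (0 : ℝ) < ∑ u, adjacency ε x u := by rw [sum_adjacency]; exact_mod_cast hd x
  have h2 : f x ≤ (∑ u, adjacency ε x u * f u) / ∑ u, adjacency ε x u := by
    rw [le_div_iff₀ hdx, Finset.mul_sum]
    refine Finset.sum_le_sum fun u hu => ?_
    rw [mul_comm]
    refine mul_le_mul_of_nonneg_left (hx u hu) ?_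
    simp only [adjacency, Matrix.of_apply]
    split_ifs <;> norm_num
  linarith

variable [MeasurableSpace V] [MeasurableSingletonClass V]

lemma lintegral_stepKernel (ε : Sym2 V → Bool) (v : V) (g : V → ℝ≥0∞) :
    ∫⁻ u, g u ∂(stepKernel ε v) = ∑ u, step ε v u * g u := by
  rw [lintegral_fintype]
  refine Finset.sum_congr rfl fun u _ => ?_
  rw [mul_comm]
  congr 1
  exact PMF.toMeasure_apply_singleton _ _ (measurableSet_singleton u)

lemma lintegral_walkLaw_zero (ε : Sym2 V → Bool) (v : V) (g : V → ℝ≥0∞) :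
    ∫⁻ x, g (x 0) ∂walkLaw ε v = g v := by
  have hg : Measurable g := measurable_of_countable g
  have hm : Measurable fun y : (i : Finset.Iic 0) → V => g (y ⟨0, Finset.mem_Iic.2 le_rfl⟩) :=
    hg.comp (measurable_pi_apply _)
  have h1 : ∫⁻ x, g (x 0) ∂walkLaw ε v
      = ∫⁻ y, g (y ⟨0, Finset.mem_Iic.2 le_rfl⟩)
        ∂(walkLaw ε v).map (Preorder.frestrictLe (π := fun _ => V) 0) := by
    rw [lintegral_map hm (by fun_prop)]
    rfl
  rw [h1, walkLaw, Kernel.trajMeasure, Measure.map_dirac, Measure.dirac_bind (by fun_prop),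
    Kernel.traj_map_frestrictLe_apply, Kernel.partialTraj_self, Kernel.id_apply,
    lintegral_dirac' _ hm]
  rfl

open Classical in
lemma lintegral_walkLaw_avoiding (ε : Sym2 V → Bool) (v w : V) (t : ℕ) (g : V → ℝ≥0∞)
    (hg : g w = 0) :
    ∫⁻ x, (if ∀ s ≤ t, x s ≠ w then g (x t) else 0) ∂walkLaw ε v
      = (killedStep ε w)^[t] g v := by
  induction t generalizing g with
  | zero =>
    rw [Function.iterate_zero, id_eq, ← lintegral_walkLaw_zero ε v g]
    refine lintegral_congr fun x => ?_
    by_cases hx : x 0 = w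
    · simp [hx, hg]
    · simp [hx]
  | succ t ih =>
    have hk : killedStep ε w g w = 0 := by simp [killedStep]
    rw [Function.iterate_succ_apply, ← ih _ hk]
    -- The history only records avoidance up to time `t`. The condition at time `t + 1` may be
    -- dropped because `g w = 0`; conditioning on the history then produces one killed step.
    set G : ((i : Finset.Iic t) → V) × V → ℝ≥0∞ :=
      fun z => if ∀ s, z.1 s ≠ w then g z.2 else 0 with hG
    have hGm : Measurable G := measurable_of_countable G
    have h1 : ∫⁻ x, (if ∀ s ≤ t + 1, x s ≠ w then g (x (t + 1)) else 0) ∂walkLaw ε v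
        = ∫⁻ x, G (Preorder.frestrictLe (π := fun _ => V) t x, x (t + 1)) ∂walkLaw ε v := by
      refine lintegral_congr fun x => ?_
      by_cases hx : x (t + 1) = w
      · simp [hG, hx, hg]
      · simp only [hG]
        refine if_congr ⟨fun h s => h s (by have := Finset.mem_Iic.1 s.2; lia), fun h s hs => ?_⟩
          rfl rfl
        rcases hs.lt_or_eq with hlt | rfl
        · exact h ⟨s, Finset.mem_Iic.2 (by lia)⟩
        · exact hx
    rw [h1, ← lintegral_map (f := G)
      (g := fun x : ℕ → V => (Preorder.frestrictLe (π := fun _ => V) t x, x (t + 1)))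
      hGm (by fun_prop), walkLaw,
      ← Kernel.map_frestrictLe_trajMeasure_compProd_eq_map_trajMeasure,
      Measure.lintegral_compProd hGm, lintegral_map (measurable_of_countable _) (by fun_prop)]
    refine lintegral_congr fun x => ?_
    have h2 : ∀ y : (i : Finset.Iic t) → V, ∫⁻ u, G (y, u) ∂historyKernel ε t y
        = if ∀ s, y s ≠ w then ∑ u, step ε (y ⟨t, Finset.mem_Iic.2 le_rfl⟩) u * g u else 0 := by
      intro y
      rw [historyKernel, Kernel.comap_apply, lintegral_stepKernel]
      by_cases hy : ∀ s, y s ≠ w <;> simp [hG, hy]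
    rw [h2]
    have h3 : (∀ s, Preorder.frestrictLe (π := fun _ => V) t x s ≠ w) ↔ ∀ s ≤ t, x s ≠ w :=
      ⟨fun h s hs => h ⟨s, Finset.mem_Iic.2 hs⟩, fun h s => h s (Finset.mem_Iic.1 s.2)⟩
    by_cases hx : ∀ s ≤ t, x s ≠ w
    · rw [if_pos hx, if_pos (h3.2 hx), killedStep, if_neg (hx t le_rfl)]
      rfl
    · rw [if_neg hx, if_neg (mt h3.1 hx)]

open Classical in
lemma hittingTime_eq_tsum (ε : Sym2 V → Bool) (v w : V) :
    hittingTime ε v w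
      = ∑' t, (killedStep ε w)^[t] (fun v => if v = w then 0 else 1) v := by
  have hm : ∀ t, Measurable fun x : ℕ → V => if ∀ s ≤ t, x s ≠ w then (1 : ℝ≥0∞) else 0 := by
    intro t
    refine Measurable.ite ?_ measurable_const measurable_const
    have : {x : ℕ → V | ∀ s ≤ t, x s ≠ w} = ⋂ s ∈ Set.Iic t, (fun x => x s) ⁻¹' {w}ᶜ := by
      ext x; simp
    rw [this]
    exact MeasurableSet.biInter (Set.to_countable _) fun s _ =>
      measurable_pi_apply s (measurableSet_singleton w).compl
  rw [hittingTime, lintegral_congr (firstHit_eq_tsum w),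
    lintegral_tsum fun t => (hm t).aemeasurable]
  refine tsum_congr fun t => ?_
  rw [← lintegral_walkLaw_avoiding ε v w t _ (by simp)]
  refine lintegral_congr fun x => ?_
  by_cases hx : ∀ s ≤ t, x s ≠ w
  · rw [if_pos hx, if_pos hx, if_neg (hx t le_rfl)]
  · rw [if_neg hx, if_neg hx]

lemma hittingTime_eq_ofReal [Nonempty V] (ε : Sym2 V → Bool) (hd : ∀ v, 0 < degree ε v) (w : V)
    (f : V → ℝ) (h0 : f w = 0)
    (hf : ∀ v, v ≠ w → f v = 1 + (∑ u, adjacency ε v u * f u) / ∑ u, adjacency ε v u) (v : V) :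
    hittingTime ε v w = ENNReal.ofReal (f v) := by
  -- Needed because `ENNReal.ofReal` truncates negative values to zero.
  have hnn := mean_hitting_times_nonneg ε hd w f h0 hf
  rw [hittingTime_eq_tsum]
  refine tsum_killedStep_iterate_eq ε w (fun v => ENNReal.ofReal (f v))
    (fun v => ENNReal.ofReal_ne_top) ?_ v
  funext u
  by_cases hu : u = w
  · simp [killedStep, hu, h0]
  · simp only [Pi.add_apply, killedStep, hu, if_false]
    rw [sum_step_mul_ofReal ε u (hd u) f hnn, ← ENNReal.ofReal_one, ← ENNReal.ofReal_add, ← hf u hu]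
    · norm_num
    · refine div_nonneg (Finset.sum_nonneg fun x _ => mul_nonneg ?_ (hnn x)) ?_
      · simp only [adjacency, Matrix.of_apply]
        split_ifs <;> norm_num
      · rw [sum_adjacency]; positivity

lemma avgHittingTime_eq_ofReal [Nonempty V] (ε : Sym2 V → Bool) (hd : ∀ v, 0 < degree ε v)
    (H : V → V → ℝ) (h0 : ∀ w, H w w = 0)
    (hH : ∀ v w, v ≠ w →
      H v w = 1 + (∑ u, adjacency ε v u * H u w) / ∑ u, adjacency ε v u) (v : V) :
    avgHittingTime ε v = ENNReal.ofReal
      (∑ w, (∑ u, adjacency ε w u) / (∑ x, ∑ u, adjacency ε x u) * H v w) := by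
  have hvol : (0 : ℝ) < ∑ x, (degree ε x : ℝ) :=
    Finset.sum_pos (fun x _ => by exact_mod_cast hd x) Finset.univ_nonempty
  simp only [sum_adjacency]
  have hnn := fun w => mean_hitting_times_nonneg ε hd w (fun v => H v w) (h0 w)
    (fun v hv => hH v w hv) v
  rw [avgHittingTime, ENNReal.ofReal_sum_of_nonneg fun w _ => mul_nonneg (by positivity) (hnn w)]
  refine Finset.sum_congr rfl fun w _ => ?_
  rw [hittingTime_eq_ofReal ε hd w (fun v => H v w) (h0 w) (fun v hv => hH v w hv),
    ENNReal.ofReal_mul (by positivity), ENNReal.ofReal_div_of_pos hvol,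
    ENNReal.ofReal_sum_of_nonneg fun x _ => Nat.cast_nonneg _]
  simp only [ENNReal.ofReal_natCast]
  rfl

end HittingTime

/-! ### Consequences of expansion for the random walk -/

section Expanding

variable {V : Type*} [Fintype V] [DecidableEq V] {ε : Sym2 V → Bool} {h : ℝ}

lemma IsExpanding.isConnected [Nonempty V] (hexp : IsExpanding (adjacency ε) h) (hh : 0 < h) :
    IsConnected ε := by
  set G := SimpleGraph.fromEdgeSet {e | ε e = true} with hG
  have hpre : G.Preconnected := by
    intro u v
    by_contra huv
    -- A component has empty boundary, and either it or its complement has at most half of the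
    -- vertices.
    set S := Finset.univ.filter fun x => G.Reachable u x with hS
    have hzero : ∀ x ∈ S, ∀ y ∈ Sᶜ, adjacency ε x y = 0 := by
      intro x hx y hy
      have hx' : G.Reachable u x := by simpa [hS] using hx
      have hy' : ¬ G.Reachable u y := by simpa [hS] using hy
      simp only [adjacency, Matrix.of_apply, ite_eq_right_iff, one_ne_zero, imp_false]
      intro hxy
      refine hy' (hx'.trans (SimpleGraph.Adj.reachable ?_))
      rw [hG, SimpleGraph.fromEdgeSet_adj]
      exact ⟨hxy, fun h => hy' (h ▸ hx')⟩
    have huS : u ∈ S := by simp [hS]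
    have hvS : v ∈ Sᶜ := by simpa [hS] using huv
    have hcard := Finset.card_add_card_compl S
    rcases le_total (2 * S.card) (Fintype.card V) with hle | hle
    · have h1 := hexp S ⟨u, huS⟩ hle
      rw [Finset.sum_eq_zero fun x hx => Finset.sum_eq_zero fun y hy => hzero x hx y hy] at h1
      have : (0 : ℝ) < S.card := by exact_mod_cast Finset.card_pos.2 ⟨u, huS⟩
      nlinarith
    · have h1 := hexp Sᶜ ⟨v, hvS⟩ (by lia)
      rw [compl_compl, Finset.sum_eq_zero fun x hx => Finset.sum_eq_zero fun y hy =>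
        ((adjacency_isSymm ε).apply y x).trans (hzero y hy x hx)] at h1
      have : (0 : ℝ) < Sᶜ.card := by exact_mod_cast Finset.card_pos.2 ⟨v, hvS⟩
      nlinarith
  exact ⟨hpre⟩

lemma IsExpanding.le_degree (hexp : IsExpanding (adjacency ε) h) (hV : 2 ≤ Fintype.card V) (v : V) :
    h ≤ degree ε v := by
  have h1 := hexp {v} (Finset.singleton_nonempty v) (by simpa using hV)
  rw [Finset.sum_singleton, Finset.card_singleton, Nat.cast_one, mul_one] at h1
  rw [← sum_adjacency]
  exact h1.trans (Finset.sum_le_univ_sum_of_nonneg fun w => adjacency_nonneg ε v w)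

lemma IsExpanding.avgHittingTime_bounds [MeasurableSpace V] [MeasurableSingletonClass V]
    (hexp : IsExpanding (adjacency ε) h) (hh : 0 < h) (hV : 2 ≤ Fintype.card V) {D : ℝ}
    (hD : ∀ v, (degree ε v : ℝ) ≤ D) (v : V) :
    ENNReal.ofReal (Fintype.card V - 2) ≤ avgHittingTime ε v ∧
      avgHittingTime ε v
        ≤ ENNReal.ofReal (Fintype.card V * (1 + 1 / h + 2 * D ^ 2 / h ^ 3)) := by
  have : Nonempty V := ⟨v⟩
  have hdeg := hexp.le_degree hV
  have hdeg0 : ∀ v, 0 < degree ε v := fun v => by exact_mod_cast hh.trans_le (hdeg v)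
  have hhD : h ≤ D := (hdeg v).trans (hD v)
  have hD0 : 0 < D := hh.trans_le hhD
  have hg1 : h ^ 2 / (2 * D ^ 2) ≤ 1 := by
    rw [div_le_one (by positivity)]
    nlinarith
  obtain ⟨H, hH0, hH, hb⟩ := exists_mean_hitting_times (adjacency_isSymm ε) (adjacency_nonneg ε)
    (adjacency_le_one ε) hh (fun v => by rw [sum_adjacency]; exact hdeg v)
    (by positivity : 0 < h ^ 2 / (2 * D ^ 2)) hg1
    (hexp.cheeger (adjacency_isSymm ε) (adjacency_nonneg ε) hh.le hD0
      fun v => by rw [sum_adjacency]; exact hD v)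
  have hring : 1 / (h * (h ^ 2 / (2 * D ^ 2))) = 2 * D ^ 2 / h ^ 3 := by
    field_simp
  rw [avgHittingTime_eq_ofReal ε hdeg0 H hH0 hH, ← hring]
  exact ⟨ENNReal.ofReal_le_ofReal (hb v).1, ENNReal.ofReal_le_ofReal (hb v).2⟩

end Expanding

/-! ### Chernoff bounds for sums of independent Bernoulli variables -/

section Chernoff

variable {E : Type*} [Fintype E] [DecidableEq E] (P : E → unitInterval)

/-- The law of independent Bernoulli variables with parameters `P`. -/
noncomputable abbrev bernoulliProduct : Measure (E → Bool) :=
  Measure.pi fun e => bernoulliMeasure true false (P e)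

lemma mgf_sum_bernoulli_le (F : Finset E) (t : ℝ) :
    mgf (fun ε : E → Bool => ∑ e ∈ F, if ε e = true then (1 : ℝ) else 0) (bernoulliProduct P) t
      ≤ Real.exp ((Real.exp t - 1) * ∑ e ∈ F, (P e : ℝ)) := by
  have h1 : ∀ ε : E → Bool, Real.exp (t * ∑ e ∈ F, if ε e = true then (1 : ℝ) else 0)
      = ∏ e, (if e ∈ F ∧ ε e = true then Real.exp t else 1) := fun ε => by
    rw [Finset.mul_sum, Real.exp_sum, ← Finset.prod_subset (Finset.subset_univ F)]
    · refine Finset.prod_congr rfl fun e he => ?_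
      by_cases hε : ε e = true <;> simp [he, hε]
    · intro e _ he
      simp [he]
  rw [mgf]
  simp only [h1]
  rw [integral_fintype_prod_eq_prod
    (f := fun e b => if e ∈ F ∧ b = true then Real.exp t else 1), Finset.mul_sum, Real.exp_sum,
    ← Finset.prod_subset (Finset.subset_univ F)]
  · refine Finset.prod_le_prod (fun e _ => integral_nonneg fun b => ?_) fun e he => ?_
    · beta_reduce
      split_ifs <;> positivity
    · rw [integral_bernoulliMeasure]
      simp only [he, true_and, if_true, Bool.false_eq_true, if_false, smul_eq_mul]
      have := Real.add_one_le_exp ((Real.exp t - 1) * (P e : ℝ))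
      linarith
  · intro e _ he
    rw [integral_bernoulliMeasure]
    simp [he]

/-- Exponential Markov at `t = -1`: since `e⁻¹ ≤ 2/5`, the exponent is at most `m/2 - 3m/5 = -m/10`.
-/
lemma measureReal_sum_bernoulli_le_half (F : Finset E) {m : ℝ} (hm : m ≤ ∑ e ∈ F, (P e : ℝ)) :
    (bernoulliProduct P).real {ε | ∑ e ∈ F, (if ε e = true then (1 : ℝ) else 0) ≤ m / 2}
      ≤ Real.exp (-m / 10) := by
  rcases le_or_gt m 0 with hm0 | hm0
  · exact measureReal_le_one.trans (Real.one_le_exp (by linarith))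
  refine (measure_le_le_exp_mul_mgf (t := -1) _ (by norm_num)
    Integrable.of_finite).trans ?_
  refine (mul_le_mul_of_nonneg_left (mgf_sum_bernoulli_le P F (-1)) (Real.exp_pos _).le).trans ?_
  rw [← Real.exp_add, Real.exp_le_exp]
  have h1 : Real.exp (-1) ≤ 2 / 5 := by
    have h2 := Real.exp_one_gt_d9
    rw [Real.exp_neg, inv_eq_one_div, div_le_div_iff₀ (Real.exp_pos _) (by norm_num)]
    linarith
  nlinarith

lemma measureReal_three_mul_le_sum_bernoulli (F : Finset E) {m : ℝ}
    (hm : ∑ e ∈ F, (P e : ℝ) ≤ m) :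
    (bernoulliProduct P).real {ε | 3 * m ≤ ∑ e ∈ F, (if ε e = true then (1 : ℝ) else 0)}
      ≤ Real.exp (-m) := by
  have hm0 : 0 ≤ m := (Finset.sum_nonneg fun e _ => (P e).2.1).trans hm
  refine (measure_ge_le_exp_mul_mgf (t := 1) _ (by norm_num)
    Integrable.of_finite).trans ?_
  refine (mul_le_mul_of_nonneg_left (mgf_sum_bernoulli_le P F 1) (Real.exp_pos _).le).trans ?_
  rw [← Real.exp_add, Real.exp_le_exp]
  have h1 := Real.exp_one_lt_d9
  have h2 := Real.exp_one_gt_d9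
  nlinarith

end Chernoff

/-! ### Expansion and degrees of the stochastic block model -/

section Model

variable {M n : ℕ} {p : Fin M → unitInterval} {q : unitInterval}

instance : IsProbabilityMeasure (law n p q) := by
  unfold law
  infer_instance

lemma sum_ite_block (m : Fin M) (a : ℝ) :
    ∑ w : Vertex M n, (if w.1 = m then a else 0) = n * a := by
  rw [Fintype.sum_prod_type' (f := fun x (_ : Fin n) => if x = m then a else 0)]
  simp

lemma sum_edgeProb_eq_expDegree (v : Vertex M n) :
    ∑ w, (edgeProb p q s(v, w) : ℝ) = expDegree n p q v.1 := by
  have h1 : ∀ w : Vertex M n, (edgeProb p q s(v, w) : ℝ)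
      = q + if w.1 = v.1 then (p v.1 : ℝ) - q else 0 := fun w => by
    by_cases hvw : v.1 = w.1
    · simp [edgeProb, hvw]
    · simp [edgeProb, hvw, Ne.symm hvw]
  simp only [h1, Finset.sum_add_distrib, sum_ite_block, Finset.sum_const, Finset.card_univ,
    Fintype.card_prod, Fintype.card_fin, nsmul_eq_mul, Nat.cast_mul, expDegree]
  ring

lemma measureReal_degree_ge (v : Vertex M n) {G : ℝ} (hG : expDegree n p q v.1 ≤ G) :
    (law n p q).real {ε | 3 * G ≤ degree ε v} ≤ Real.exp (-G) := by
  have hinj : Set.InjOn (fun w : Vertex M n => s(v, w)) (Finset.univ : Finset (Vertex M n)) :=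
    fun w _ w' _ hww => Sym2.congr_right.1 hww
  have h1 := measureReal_three_mul_le_sum_bernoulli (edgeProb p q)
    (Finset.univ.image fun w : Vertex M n => s(v, w)) (m := G) (by
      rwa [Finset.sum_image hinj, sum_edgeProb_eq_expDegree])
  simp only [Finset.sum_image hinj] at h1
  have h2 : ∀ ε : Sym2 (Vertex M n) → Bool,
      ∑ w, (if ε s(v, w) = true then (1 : ℝ) else 0) = degree ε v := fun ε => sum_adjacency ε v
  simp only [h2] at h1
  exact h1

/-- Only pairs in different blocks are counted. If `S` has `s m` vertices in block `m`, there are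
`|S| (M n - |S| - n) + ∑ (s m)²` such pairs; Cauchy–Schwarz gives `∑ (s m)² ≥ |S|² / M`, and `|S| ≤
M n / 2` does the rest. -/
lemma le_sum_cut_edgeProb (S : Finset (Vertex M n)) (hS : 2 * S.card ≤ M * n) :
    ((M : ℝ) - 1) * n * q * S.card / 2 ≤ ∑ v ∈ S, ∑ w ∈ Sᶜ, (edgeProb p q s(v, w) : ℝ) := by
  rcases Nat.eq_zero_or_pos M with rfl | hM
  · have : S = ∅ := Finset.eq_empty_of_isEmpty S
    simp [this]
  have hM' : (1 : ℝ) ≤ M := by exact_mod_cast hM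
  set s : Fin M → ℝ := fun m => (S.filter fun v => v.1 = m).card with hs
  have hq0 : (0 : ℝ) ≤ q := q.2.1
  have hlow : ∑ v ∈ S, ∑ w ∈ Sᶜ, (q : ℝ) * (if w.1 = v.1 then 0 else 1)
      ≤ ∑ v ∈ S, ∑ w ∈ Sᶜ, (edgeProb p q s(v, w) : ℝ) := by
    refine Finset.sum_le_sum fun v _ => Finset.sum_le_sum fun w _ => ?_
    by_cases hvw : v.1 = w.1
    · simpa [edgeProb, hvw] using (p w.1).2.1
    · simp [edgeProb, hvw, Ne.symm hvw]
  refine le_trans ?_ hlow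
  have hinner : ∀ v : Vertex M n, ∑ w ∈ Sᶜ, (q : ℝ) * (if w.1 = v.1 then 0 else 1)
      = q * ((M : ℝ) * n - S.card - (n - s v.1)) := fun v => by
    rw [← Finset.mul_sum]
    congr 1
    have h1 : ∀ w : Vertex M n, (if w.1 = v.1 then (0 : ℝ) else 1)
        = 1 - if w.1 = v.1 then 1 else 0 := fun w => by split_ifs <;> norm_num
    have h2 : ∑ w : Vertex M n, (if w.1 = v.1 then (0 : ℝ) else 1) = M * n - n := by
      simp only [h1, Finset.sum_sub_distrib, sum_ite_block, Finset.sum_const, Finset.card_univ,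
        Fintype.card_prod, Fintype.card_fin, nsmul_eq_mul, Nat.cast_mul, mul_one]
    have h3 : ∑ w ∈ S, (if w.1 = v.1 then (0 : ℝ) else 1) = S.card - s v.1 := by
      simp only [h1, Finset.sum_sub_distrib, Finset.sum_boole]
      simp [hs]
    have h4 := Finset.sum_add_sum_compl S fun w : Vertex M n => if w.1 = v.1 then (0 : ℝ) else 1
    linarith
  have hfib : ∑ v ∈ S, s v.1 = ∑ m, s m ^ 2 := by
    rw [← Finset.sum_fiberwise S (fun v => v.1)]
    refine Finset.sum_congr rfl fun m _ => ?_
    rw [Finset.sum_congr rfl fun v hv => by rw [(Finset.mem_filter.1 hv).2], Finset.sum_const,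
      nsmul_eq_mul, pow_two]
  have hcard : ∑ m, s m = S.card := by
    have := Finset.card_eq_sum_card_fiberwise (s := S) (t := Finset.univ) (f := fun v => v.1)
      fun v _ => Finset.mem_univ _
    rw [this]
    push_cast
    rfl
  have hCS : (S.card : ℝ) ^ 2 ≤ M * ∑ m, s m ^ 2 := by
    have := sq_sum_le_card_mul_sum_sq (s := Finset.univ) (f := s)
    rwa [hcard, Finset.card_univ, Fintype.card_fin] at this
  have htotal : ∑ v ∈ S, ∑ w ∈ Sᶜ, (q : ℝ) * (if w.1 = v.1 then 0 else 1)
      = q * (S.card * ((M : ℝ) * n - S.card - n) + ∑ m, s m ^ 2) := by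
    rw [Finset.sum_congr rfl fun v _ => hinner v, ← Finset.mul_sum, ← hfib]
    congr 1
    simp only [Finset.sum_sub_distrib, Finset.sum_const, nsmul_eq_mul]
    ring
  rw [htotal]
  have hS' : 2 * (S.card : ℝ) ≤ M * n := by exact_mod_cast hS
  have hkey : ((M : ℝ) - 1) * n * S.card / 2
      ≤ S.card * ((M : ℝ) * n - S.card - n) + ∑ m, s m ^ 2 := by
    have hc0 : (0 : ℝ) ≤ S.card := Nat.cast_nonneg _
    have h5 : 0 ≤ S.card * ((M : ℝ) - 1) * (M * n - 2 * S.card) :=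
      mul_nonneg (mul_nonneg hc0 (by linarith)) (by linarith)
    refine le_of_mul_le_mul_left ?_ (lt_of_lt_of_le one_pos hM')
    nlinarith
  calc ((M : ℝ) - 1) * n * q * S.card / 2 = q * (((M : ℝ) - 1) * n * S.card / 2) := by ring
    _ ≤ _ := mul_le_mul_of_nonneg_left hkey hq0

lemma measureReal_cut_le (S : Finset (Vertex M n)) (hS : 2 * S.card ≤ M * n) :
    (law n p q).real {ε | ∑ v ∈ S, ∑ w ∈ Sᶜ, adjacency ε v w
        ≤ ((M : ℝ) - 1) * n * q / 4 * S.card}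
      ≤ Real.exp (-(((M : ℝ) - 1) * n * q) / 20) ^ S.card := by
  -- Different pairs in `S × Sᶜ` are different unordered edges, so the cut is a sum of independent
  -- variables.
  have hinj : Set.InjOn (fun z : Vertex M n × Vertex M n => s(z.1, z.2))
      (S ×ˢ Sᶜ : Finset (Vertex M n × Vertex M n)) := by
    rintro ⟨a, b⟩ hab ⟨a', b'⟩ hab' heq
    simp only [Finset.coe_product, Set.mem_prod, Finset.mem_coe, Finset.mem_compl] at hab hab'
    rcases Sym2.eq_iff.1 heq with ⟨h1, h2⟩ | ⟨h1, h2⟩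
    · exact Prod.ext h1 h2
    · have h1' : a = b' := h1
      exact absurd (h1' ▸ hab.1) hab'.2
  have h1 := measureReal_sum_bernoulli_le_half (edgeProb p q)
    ((S ×ˢ Sᶜ).image fun z => s(z.1, z.2)) (m := ((M : ℝ) - 1) * n * q * S.card / 2) (by
      rw [Finset.sum_image hinj, Finset.sum_product]
      exact le_sum_cut_edgeProb S hS)
  simp only [Finset.sum_image hinj, Finset.sum_product] at h1
  rw [show ((M : ℝ) - 1) * n * q * S.card / 2 / 2 = ((M : ℝ) - 1) * n * q / 4 * S.card by ring]
    at h1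
  rw [← Real.exp_nat_mul, show (S.card : ℝ) * (-(((M : ℝ) - 1) * n * q) / 20)
    = -(((M : ℝ) - 1) * n * q * S.card / 2) / 10 by ring]
  exact h1

/-- With high probability the model is expanding and has bounded degrees. -/
lemma measureReal_not_expanding_le (hN : 2 ≤ M * n) {G : ℝ}
    (hG : ∀ m, expDegree n p q m ≤ G)
    (hc : 40 * Real.log (M * n : ℕ) ≤ ((M : ℝ) - 1) * n * q) :
    (law n p q).real {ε | ¬ (IsExpanding (adjacency ε) (((M : ℝ) - 1) * n * q / 4) ∧
        ∀ v, (degree ε v : ℝ) ≤ 3 * G)} ≤ 3 / (M * n : ℕ) := by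
  set N : ℕ := M * n with hNdef
  set c : ℝ := ((M : ℝ) - 1) * n * q with hcdef
  set x : ℝ := Real.exp (-c / 20) with hx
  have hN0 : (0 : ℝ) < N := by
    have : 0 < N := by lia
    exact_mod_cast this
  have hlog : 0 ≤ Real.log N := Real.log_natCast_nonneg N
  have hx0 : 0 < x := Real.exp_pos _
  have hxN : N * x ≤ 1 / N := by
    have h1 : x ≤ Real.exp (-(Real.log N + Real.log N)) := Real.exp_le_exp.2 (by linarith)
    rw [Real.exp_neg, Real.exp_add, Real.exp_log hN0] at h1
    calc N * x ≤ N * (N * N : ℝ)⁻¹ := mul_le_mul_of_nonneg_left h1 hN0.le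
      _ = 1 / N := by field_simp
  have hNx1 : N * x ≤ 1 := hxN.trans (by
    rw [div_le_one hN0]
    have : 1 ≤ N := by lia
    exact_mod_cast this)
  have hcardV : Fintype.card (Vertex M n) = N := by simp [hNdef]
  set T : Finset (Finset (Vertex M n)) :=
    Finset.univ.filter fun S => S.Nonempty ∧ 2 * S.card ≤ N with hT
  have hsub : {ε : Sym2 (Vertex M n) → Bool | ¬ (IsExpanding (adjacency ε) (c / 4) ∧
        ∀ v, (degree ε v : ℝ) ≤ 3 * G)}
      ⊆ (⋃ S ∈ T, {ε | ∑ v ∈ S, ∑ w ∈ Sᶜ, adjacency ε v w ≤ c / 4 * S.card})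
        ∪ ⋃ v ∈ Finset.univ, {ε | 3 * G ≤ degree ε v} := by
    intro ε hε
    simp only [Set.mem_ofPred_eq, not_and_or] at hε
    rcases hε with hε | hε
    · left
      simp only [IsExpanding, not_forall] at hε
      obtain ⟨S, hS1, hS2, hS3⟩ := hε
      rw [hcardV] at hS2
      exact Set.mem_biUnion (x := S) (by simp [hT, hS1, hS2]) (not_le.1 hS3).le
    · right
      push Not at hε
      obtain ⟨v, hv⟩ := hε
      exact Set.mem_biUnion (x := v) (by simp) hv.le
  have hb1 : (law n p q).real (⋃ S ∈ T, {ε | ∑ v ∈ S, ∑ w ∈ Sᶜ, adjacency ε v w ≤ c / 4 * S.card})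
      ≤ 2 * (N * x) := by
    -- The failure probability of `S` is at most `x ^ |S|`, so the binomial theorem sums the union
    -- bound; `x ≤ N⁻²` makes the total small.
    have h1 : ∑ S ∈ T, x ^ S.card ≤ (1 + x) ^ N - 1 := by
      have h2 : (1 + x) ^ N = ∑ S : Finset (Vertex M n), x ^ S.card := by
        rw [← hcardV, add_comm, ← Fintype.sum_pow_mul_eq_add_pow]
        simp
      rw [h2, ← Finset.sum_erase_add _ _ (Finset.mem_univ ∅), Finset.card_empty, pow_zero,
        add_sub_cancel_right]
      refine Finset.sum_le_sum_of_subset_of_nonneg (fun S hS => ?_) fun S _ _ => by positivity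
      have : S.Nonempty := (Finset.mem_filter.1 hS).2.1
      exact Finset.mem_erase.2 ⟨this.ne_empty, Finset.mem_univ S⟩
    have h3 : (1 + x) ^ N ≤ Real.exp (N * x) := by
      rw [Real.exp_nat_mul]
      exact pow_le_pow_left₀ (by positivity) (by linarith [Real.add_one_le_exp x]) N
    have h4 := Real.abs_exp_sub_one_le (x := N * x) (by rwa [abs_of_nonneg (by positivity)])
    rw [abs_of_nonneg (a := N * x) (by positivity)] at h4
    have h5 := le_abs_self (Real.exp (N * x) - 1)
    refine (measureReal_biUnion_finset_le _ _).trans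
      ((Finset.sum_le_sum fun S hS => measureReal_cut_le S (Finset.mem_filter.1 hS).2.2).trans ?_)
    linarith
  have hb2 : (law n p q).real (⋃ v ∈ (Finset.univ : Finset (Vertex M n)), {ε | 3 * G ≤ degree ε v})
      ≤ N * x := by
    refine (measureReal_biUnion_finset_le _ _).trans ?_
    rw [← hcardV, ← nsmul_eq_mul]
    refine Finset.sum_le_card_nsmul _ _ _ fun v _ => (measureReal_degree_ge v (hG v.1)).trans ?_
    refine Real.exp_le_exp.2 ?_
    have h1 : c ≤ G := by
      refine le_trans ?_ (hG v.1)
      have : 0 ≤ (n : ℝ) * p v.1 := mul_nonneg (Nat.cast_nonneg _) (p v.1).2.1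
      rw [expDegree]
      linarith
    linarith
  calc _ ≤ _ := measureReal_mono hsub
    _ ≤ _ := measureReal_union_le _ _
    _ ≤ 3 * (N * x) := by linarith
    _ ≤ 3 * (1 / N) := by linarith
    _ = 3 / N := by ring

end Model

/-! ### From the asymptotic conditions to the quantitative event -/

section Asymptotic

/-- Here `a = n p_min`, `b = n p_max` and `c = (M - 1) n q`. If `a ≤ c`, then `h1` suffices alone.
Otherwise `h1` gives `(4K)² L⁴ b² ≤ a³`, and the fifth power of this times the third power of `h2`
eliminates `a`. -/
lemma cut_dominates {a b c L K : ℝ} (ha : 0 ≤ a) (hab : a ≤ b) (hc : 0 ≤ c) (hL : 1 ≤ L)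
    (hK : 1 ≤ K) (h1 : 128 * K ^ 2 * (L ^ 4 * (b + c) ^ 2) ≤ (a + c) ^ 3)
    (h2 : L * a ^ 5 * b ^ 2 ≤ c ^ 8) : K * L * (b + c) ^ 2 ≤ c ^ 3 := by
  have hb : 0 ≤ b := ha.trans hab
  have hL4 : L ≤ L ^ 4 := le_self_pow₀ hL (by norm_num)
  have hK2 : K ≤ K ^ 2 := le_self_pow₀ hK (by norm_num)
  rcases le_or_gt a c with hac | hac
  · have h3 : (a + c) ^ 3 ≤ (2 * c) ^ 3 := pow_le_pow_left₀ (by positivity) (by linarith) 3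
    have h4 : K * L * (b + c) ^ 2 ≤ K ^ 2 * (L ^ 4 * (b + c) ^ 2) := by
      rw [← mul_assoc]
      gcongr
    have h5 : 0 ≤ c ^ 3 := by positivity
    nlinarith
  · have h3 : (a + c) ^ 3 ≤ (2 * a) ^ 3 := pow_le_pow_left₀ (by positivity) (by linarith) 3
    have h4 : b ^ 2 ≤ (b + c) ^ 2 := pow_le_pow_left₀ hb (by linarith) 2
    have h5 : (4 * K) ^ 2 * (L ^ 4 * b ^ 2) ≤ a ^ 3 := by
      have : 128 * K ^ 2 * (L ^ 4 * b ^ 2) ≤ 128 * K ^ 2 * (L ^ 4 * (b + c) ^ 2) := by gcongr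
      nlinarith
    have h6 : (b + c) ^ 2 ≤ (2 * b) ^ 2 := pow_le_pow_left₀ (by positivity) (by linarith) 2
    have h7 : (4 * K * L * b ^ 2) ^ 8 ≤ (c ^ 3) ^ 8 := by
      calc (4 * K * L * b ^ 2) ^ 8 = (4 * K) ^ 8 * L ^ 8 * b ^ 16 := by ring
        _ ≤ (4 * K) ^ 10 * L ^ 23 * b ^ 16 := by
            gcongr
            · linarith
            · norm_num
            · norm_num
        _ = L ^ 3 * ((4 * K) ^ 2 * (L ^ 4 * b ^ 2)) ^ 5 * b ^ 6 := by ring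
        _ ≤ L ^ 3 * (a ^ 3) ^ 5 * b ^ 6 := by gcongr
        _ = (L * a ^ 5 * b ^ 2) ^ 3 := by ring
        _ ≤ (c ^ 8) ^ 3 := by gcongr
        _ = (c ^ 3) ^ 8 := by ring
    have h8 : 4 * K * L * b ^ 2 ≤ c ^ 3 := le_of_pow_le_pow_left₀ (by norm_num) (by positivity) h7
    calc K * L * (b + c) ^ 2 ≤ K * L * (2 * b) ^ 2 := by gcongr
      _ = 4 * K * L * b ^ 2 := by ring
      _ ≤ c ^ 3 := h8

lemma pow_four_of_rpow_le {n L x y Q : ℝ} (hn : 0 < n) (hL : 0 ≤ L) (hx : 0 ≤ x) (hy : 0 ≤ y)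
    (h : (L / n) ^ (1 / 4 : ℝ) * x ^ (5 / 4 : ℝ) * y ^ (1 / 2 : ℝ) ≤ Q ^ 2) :
    L * (n * x) ^ 5 * (n * y) ^ 2 ≤ (n * Q) ^ 8 := by
  have hr : ∀ (z : ℝ) (r : ℝ) (j : ℕ), 0 ≤ z → r * 4 = j → (z ^ r) ^ 4 = z ^ j := by
    intro z r j hz hrj
    rw [← Real.rpow_natCast, ← Real.rpow_mul hz, ← Real.rpow_natCast z j, ← hrj, Nat.cast_ofNat]
  have h4 := pow_le_pow_left₀ (by positivity) h 4
  rw [mul_pow, mul_pow, hr (L / n) _ 1 (by positivity) (by norm_num),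
    hr x _ 5 hx (by norm_num), hr y _ 2 hy (by norm_num), pow_one] at h4
  calc L * (n * x) ^ 5 * (n * y) ^ 2 = n ^ 8 * (L / n * x ^ 5 * y ^ 2) := by
        field_simp
    _ ≤ n ^ 8 * (Q ^ 2) ^ 4 := by gcongr
    _ = (n * Q) ^ 8 := by ring

variable {M n : ℕ} {p : Fin M → unitInterval} {q : unitInterval}

/-- The event of the theorem for a single model, under the quantitative form of the conditions. -/
lemma one_sub_le_law_hittingTime {K G δ : ℝ} (hN3 : 3 ≤ M * n) (hδ : 0 < δ)
    (hδN : 2 ≤ δ * (M * n : ℕ)) (hK : 40 ≤ K) (hKδ : 1156 / δ ≤ K) (hG0 : 0 < G)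
    (hG : ∀ m, expDegree n p q m ≤ G)
    (hcut : K * Real.log (M * n : ℕ) * G ^ 2 ≤ (((M : ℝ) - 1) * n * q) ^ 3) :
    1 - ENNReal.ofReal (3 / (M * n : ℕ)) ≤ law n p q
      {ε | IsConnected ε ∧ ∀ v,
        ENNReal.ofReal ((1 - δ) * (M * n : ℕ)) ≤ avgHittingTime ε v ∧
        avgHittingTime ε v ≤ ENNReal.ofReal ((1 + δ) * (M * n : ℕ))} := by
  set N : ℕ := M * n with hN
  set c : ℝ := ((M : ℝ) - 1) * n * q with hc
  have hN3' : (3 : ℝ) ≤ N := by exact_mod_cast hN3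
  have hL : 1 ≤ Real.log N := by
    rw [Real.le_log_iff_exp_le (by linarith)]
    linarith [Real.exp_one_lt_d9]
  have hcard : Fintype.card (Vertex M n) = N := by simp [hN]
  have : Nonempty (Vertex M n) := Fintype.card_pos_iff.1 (by lia)
  have hK0 : 0 < K := by linarith
  -- Positivity of `c` is not assumed: it comes from `hcut`, as an odd power is positive only for a
  -- positive base.
  have hc0 : 0 < c := by
    have : 0 < c ^ 3 := lt_of_lt_of_le (by positivity) hcut
    exact (Odd.pow_pos_iff (by decide : Odd 3)).1 this
  obtain ⟨v₀⟩ := ‹Nonempty (Vertex M n)›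
  have hcG : c ≤ G := by
    refine le_trans ?_ (hG v₀.1)
    have : 0 ≤ (n : ℝ) * p v₀.1 := mul_nonneg (Nat.cast_nonneg _) (p v₀.1).2.1
    rw [expDegree]
    linarith
  have hKL : K * Real.log N ≤ c := by
    have h1 : K * Real.log N * c ^ 2 ≤ K * Real.log N * G ^ 2 := by gcongr
    refine le_of_mul_le_mul_right (a := c ^ 2) ?_ (by positivity)
    nlinarith
  have hKc : K ≤ c := by nlinarith
  have hKG : K * G ^ 2 ≤ c ^ 3 := by
    refine le_trans ?_ hcut
    have : 0 ≤ K * G ^ 2 := by positivity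
    nlinarith
  have hbad := measureReal_not_expanding_le (p := p) (q := q) (by lia) hG
    (show 40 * Real.log N ≤ c by nlinarith)
  set Good : Set (Sym2 (Vertex M n) → Bool) := {ε | IsExpanding (adjacency ε) (c / 4) ∧
    ∀ v, (degree ε v : ℝ) ≤ 3 * G} with hGood
  have hsub : Good ⊆ {ε | IsConnected ε ∧ ∀ v,
        ENNReal.ofReal ((1 - δ) * N) ≤ avgHittingTime ε v ∧
        avgHittingTime ε v ≤ ENNReal.ofReal ((1 + δ) * N)} := by
    rintro ε ⟨hexp, hdeg⟩
    have : Nonempty (Vertex M n) := ⟨v₀⟩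
    refine ⟨hexp.isConnected (by positivity), fun v => ?_⟩
    have hb := hexp.avgHittingTime_bounds (by positivity) (by lia) hdeg v
    rw [hcard] at hb
    refine ⟨le_trans (ENNReal.ofReal_le_ofReal (by linarith)) hb.1,
      hb.2.trans (ENNReal.ofReal_le_ofReal ?_)⟩
    rw [mul_comm]
    refine mul_le_mul_of_nonneg_right ?_ (Nat.cast_nonneg _)
    have h1 : 1 / (c / 4) ≤ 4 / K := by
      rw [one_div_div]
      gcongr
    -- Here `1152 = 2 · 3² · 4³`; with the 4 from the previous term this makes the 1156 in `hKδ`.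
    have h2 : 2 * (3 * G) ^ 2 / (c / 4) ^ 3 ≤ 1152 / K := by
      rw [div_le_div_iff₀ (by positivity) hK0]
      nlinarith
    have h3 : 1156 / K ≤ δ := by
      rw [div_le_iff₀ hδ] at hKδ
      rw [div_le_iff₀ hK0]
      linarith
    have h4 : 4 / K + 1152 / K = 1156 / K := by rw [← add_div]; norm_num
    linarith
  have hbad' : law n p q Goodᶜ ≤ ENNReal.ofReal (3 / N) := by
    rw [← ofReal_measureReal]
    exact ENNReal.ofReal_le_ofReal hbad
  refine le_trans (tsub_le_iff_right.2 ?_) (measure_mono hsub)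
  calc 1 = law n p q Set.univ := measure_univ.symm
    _ ≤ law n p q Good + law n p q Goodᶜ := measure_univ_le_add_compl _
    _ ≤ _ := by gcongr

end Asymptotic

end SBM

theorem theorem1p1
    -- number of blocks, block size, number of vertices of the `k`-th model
    (M n N : ℕ → ℕ) (hM : ∀ k, 1 ≤ M k) (hN : ∀ k, N k = M k * n k)
    -- `N → ∞` and `M = o(N)`; for a constant number of blocks this just says `N → ∞`
    (hN_top : Tendsto N atTop atTop)
    (hMN : (fun k => (M k : ℝ)) =o[atTop] fun k => (N k : ℝ))
    -- edge probabilities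
    (p : (k : ℕ) → Fin (M k) → unitInterval) (q : ℕ → unitInterval)
    -- the expected degrees are positive for large `k`, so that the quotients below make sense
    (hpos : ∀ᶠ k in atTop, ∀ m, 0 < SBM.expDegree (n k) (p k) (q k) m)
    -- connectivity condition
    (hconn : ∀ m : (k : ℕ) → Fin (M k), Tendsto (fun k =>
        (M k : ℝ) * Real.log (N k) ^ 4 /
            ((N k : ℝ) * (p k (m k) : ℝ) + (N k : ℝ) * ((M k : ℝ) - 1) * (q k : ℝ))
          * ((⨆ i, SBM.expDegree (n k) (p k) (q k) i) ^ 2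
            / (⨅ i, SBM.expDegree (n k) (p k) (q k) i) ^ 2)) atTop (𝓝 0))
    -- lower bound on `q`
    (hq : (fun k => ((M k : ℝ) * Real.log (N k) / (N k : ℝ)) ^ (1 / 4 : ℝ)
          * (⨅ i, (p k i : ℝ)) ^ (5 / 4 : ℝ) * (⨆ i, (p k i : ℝ)) ^ (1 / 2 : ℝ))
        =o[atTop] fun k => (((M k : ℝ) - 1) * (q k : ℝ)) ^ 2) :
    ∀ δ : ℝ, 0 < δ → Tendsto (fun k => SBM.law (n k) (p k) (q k)
        {ε | SBM.IsConnected ε ∧ ∀ v,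
          ENNReal.ofReal ((1 - δ) * N k) ≤ SBM.avgHittingTime ε v ∧
          SBM.avgHittingTime ε v ≤ ENNReal.ofReal ((1 + δ) * N k)}) atTop (𝓝 1) := by
  intro δ hδ
  have hNR : Tendsto (fun k => (N k : ℝ)) atTop atTop :=
    tendsto_natCast_atTop_atTop.comp hN_top
  set K : ℝ := 40 + 1156 / δ with hK
  have hK0 : 0 < 1156 / δ := by positivity
  have hne : ∀ k, Nonempty (Fin (M k)) := fun k => ⟨⟨0, hM k⟩⟩
  -- Blocks attaining `p_min` and `p_max`, hence also the extreme expected degrees `a + c` and `b +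
  -- c`. The connectivity condition is needed only along the minimizing blocks.
  choose i hi using fun k =>
    haveI := hne k
    exists_eq_ciInf_of_finite (f := fun i => (p k i : ℝ))
  choose j hj using fun k =>
    haveI := hne k
    exists_eq_ciSup_of_finite (f := fun i => (p k i : ℝ))
  have hconn' := (hconn i).eventually_lt_const
    (show (0 : ℝ) < 1 / (128 * K ^ 2) by positivity)
  have hq' := hq.def one_pos
  have key : ∀ᶠ k in atTop, 1 - ENNReal.ofReal (3 / N k) ≤ SBM.law (n k) (p k) (q k)
      {ε | SBM.IsConnected ε ∧ ∀ v,
        ENNReal.ofReal ((1 - δ) * N k) ≤ SBM.avgHittingTime ε v ∧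
        SBM.avgHittingTime ε v ≤ ENNReal.ofReal ((1 + δ) * N k)} := by
    filter_upwards [hconn', hq', hpos, hN_top.eventually_ge_atTop 3,
      hNR.eventually_ge_atTop (2 / δ)] with k hk1 hk2 hk3 hk4 hk5
    have := hne k
    have hNk := hN k
    have hn0 : 0 < n k := Nat.pos_of_ne_zero fun h => by simp [h] at hNk; lia
    have hn : (0 : ℝ) < n k := by exact_mod_cast hn0
    have hMk : (1 : ℝ) ≤ M k := by exact_mod_cast hM k
    have hNR' : (N k : ℝ) = M k * n k := by rw [hNk]; push_cast; rfl
    have hL : 1 ≤ Real.log (N k) := by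
      have : (3 : ℝ) ≤ N k := by exact_mod_cast hk4
      rw [Real.le_log_iff_exp_le (by linarith)]
      linarith [Real.exp_one_lt_d9]
    set a : ℝ := n k * (p k (i k) : ℝ) with ha
    set b : ℝ := n k * (p k (j k) : ℝ) with hb
    set c : ℝ := ((M k : ℝ) - 1) * n k * (q k : ℝ) with hc
    have hq0 : (0 : ℝ) ≤ q k := (q k).2.1
    have hc0 : 0 ≤ c := mul_nonneg (mul_nonneg (by linarith) hn.le) hq0
    have ha0 : 0 ≤ a := mul_nonneg hn.le (p k (i k)).2.1
    have hle_max : ∀ m, (p k m : ℝ) ≤ p k (j k) := fun m => by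
      rw [hj]
      exact le_ciSup (f := fun m => (p k m : ℝ)) (Set.finite_range _).bddAbove m
    have hab : a ≤ b := mul_le_mul_of_nonneg_left (hle_max _) hn.le
    have hac : 0 < a + c := hk3 (i k)
    have hbc : 0 ≤ b + c := by linarith
    have h1 : 128 * K ^ 2 * (Real.log (N k) ^ 4 * (b + c) ^ 2) ≤ (a + c) ^ 3 := by
      set s := ⨆ m, SBM.expDegree (n k) (p k) (q k) m with hs
      set t := ⨅ m, SBM.expDegree (n k) (p k) (q k) m with ht
      have hsb : b + c ≤ s :=
        le_ciSup (f := SBM.expDegree (n k) (p k) (q k)) (Set.finite_range _).bddAbove (j k)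
      have hta : t ≤ a + c :=
        ciInf_le (f := SBM.expDegree (n k) (p k) (q k)) (Set.finite_range _).bddBelow (i k)
      have ht0 : 0 < t := by
        obtain ⟨m, hm⟩ := exists_eq_ciInf_of_finite (f := SBM.expDegree (n k) (p k) (q k))
        rw [ht, ← hm]
        exact hk3 m
      -- Since `N = M n`, the denominator is `M (a + c)` and the factor `M` cancels.
      have hden : (N k : ℝ) * (p k (i k) : ℝ) + (N k : ℝ) * ((M k : ℝ) - 1) * (q k : ℝ)
          = M k * (a + c) := by
        rw [hNR']; ring
      rw [hden, mul_div_mul_left _ _ (by positivity)] at hk1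
      have h2 : Real.log (N k) ^ 4 * (b + c) ^ 2 / (a + c) ^ 3 ≤ 1 / (128 * K ^ 2) := by
        refine le_trans ?_ hk1.le
        rw [show (a + c) ^ 3 = (a + c) * (a + c) ^ 2 by ring, mul_div_mul_comm]
        gcongr
      rw [div_le_div_iff₀ (by positivity) (by positivity)] at h2
      linarith
    have h2 : Real.log (N k) * a ^ 5 * b ^ 2 ≤ c ^ 8 := by
      have hdiv : (M k : ℝ) * Real.log (N k) / N k = Real.log (N k) / n k := by
        rw [hNR', mul_div_mul_left _ _ (by positivity : (M k : ℝ) ≠ 0)]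
      rw [← hi, ← hj, one_mul, Real.norm_of_nonneg (sq_nonneg _), hdiv, Real.norm_of_nonneg
        (mul_nonneg (mul_nonneg (Real.rpow_nonneg (by positivity) _)
          (Real.rpow_nonneg (p k (i k)).2.1 _)) (Real.rpow_nonneg (p k (j k)).2.1 _))] at hk2
      have h3 := SBM.pow_four_of_rpow_le hn (by linarith) (p k (i k)).2.1 (p k (j k)).2.1 hk2
      rwa [show (n k : ℝ) * (((M k : ℝ) - 1) * (q k : ℝ)) = c by rw [hc]; ring] at h3
    have hcut := SBM.cut_dominates ha0 hab hc0 hL (by linarith : (1 : ℝ) ≤ K) h1 h2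
    have hfinal := SBM.one_sub_le_law_hittingTime (n := n k) (p := p k) (q := q k)
      (K := K) (G := b + c)
      (by rwa [← hNk]) hδ (by
        rw [div_le_iff₀ hδ] at hk5
        rw [← hNk]
        linarith) (by linarith) (by linarith)
        (by linarith)
      (fun m => by
        have := mul_le_mul_of_nonneg_left (hle_max m) hn.le
        rw [SBM.expDegree]
        linarith) (by rw [← hNk]; exact hcut)
    rwa [← hNk] at hfinal
  have hlim : Tendsto (fun k => 1 - ENNReal.ofReal (3 / N k)) atTop (𝓝 1) := by
    have h1 : Tendsto (fun k => ENNReal.ofReal (3 / N k)) atTop (𝓝 0) := by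
      simpa using ENNReal.tendsto_ofReal (hNR.const_div_atTop 3)
    simpa using ENNReal.Tendsto.sub (tendsto_const_nhds (x := (1 : ℝ≥0∞))) h1
      (Or.inl ENNReal.one_ne_top)
  exact tendsto_of_tendsto_of_tendsto_of_le_of_le' hlim tendsto_const_nhds key
    (Eventually.of_forall fun k => prob_le_one)
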